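/- **Theorem (Tractability of symmetric problems, absolute error).** Let $S_1\colon H_1\to G_1$ be a compact linear operator between two real Hilbert spaces, and let $\lambda_1\ge\lambda_2\ge\dots\ge 0$ be the eigenvalues of $W_1=S_1^\dagger S_1$ in non-increasing order: the positive eigenvalues, each repeated according to its multiplicity, followed by zeros if there are only finitely many of them. Assume $\lambda_2>0$ and $\lambda_1\le 1$. For $d\in\mathbb N=\{1,2,\dots\}$ let $H_d=H_1\otimes\dots\otimes H_1$ and $G_d=G_1\otimes\dots\otimes G_1$ be the $d$-fold Hilbert space tensor products, with $\langle\bigotimes_l f_l,\bigotimes_l g_l\rangle=\prod_l\langle f_l,g_l\rangle$, and let $S_d=S_1\otimes\dots\otimes S_1\colon H_d\to G_d$. Let $I_d\subset\{1,\dots,d\}$, with $I_d\ne\emptyset$ for $d>1$, let $\mathcal S_{I_d}$ be the set of all permutations of $\{1,\dots,d\}$ that fix every element outside $I_d$, and let $\mathfrak S_{I_d}$ be the symmetrizer, i.e. the continuous linear operator on $H_d$ with $\mathfrak S_{I_d}(\bigotimes_l f_l)=\frac1{\#\mathcal S_{I_d}}\sum_{\pi\in\mathcal S_{I_d}}\bigotimes_l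 f_{\pi(l)}$. The $I_d$-symmetric problem is the restriction of $S_d$ to $F_d=\mathfrak S_{I_d}(H_d)$. For $n\in\mathbb N_0$ let $$e(n,d)=\inf_{A}\ \sup_{f\in F_d,\ \|f\|\le 1}\|A(f)-S_d f\|_{G_d},$$ where the infimum is over all algorithms $A=\varphi\circ N$ with an arbitrary map $\varphi\colon\mathbb R^n\to G_d$ and $N(f)=(y_1,\dots,y_n)$, $y_v=L_v(f;y_1,\dots,y_{v-1})$, such that every $L_v(\,\cdot\,;y_1,\dots,y_{v-1})$ is a continuous linear functional on $F_d$, which may depend on the values $y_1,\dots,y_{v-1}$ obtained before. Let $n(\varepsilon,d)=\min\{n\in\mathbb N_0: e(n,d)\le\varepsilon\}$ be the information complexity. The problem is called *polynomially tractable* if there are $C,p>0$ and $q\ge0$ such that $n(\varepsilon,d)\le C\,\varepsilon^{-p}d^{\,q}$ for all $d\in\mathbb N$ and $\varepsilon\in(0,1]$, and *strongly polynomially tractable* if this holds with $q=0$. Then the $I_d$-symmetric problem is strongly polynomially tractable if and only if $\sum_m\lambda_m^\tau<\infty$ for some $\tau\in(0,\infty)$ and * $\lambda_1<1$, or * $\lambda_1=1>\lambda_2$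 and $d-\#I_d=O(1)$ as $d\to\infty$. Moreover, it is polynomially tractable if and only if $\sum_m\lambda_m^\tau<\infty$ for some $\tau\in(0,\infty)$ and * $\lambda_1<1$, or * $\lambda_1=1$ and $d-\#I_d=O(\ln d)$ as $d\to\infty$. -/

import Mathlib

open scoped TensorProduct ENNReal Asymptotics

noncomputable section

namespace TensorProblem

/-! ### The `d`-fold Hilbert space tensor power -/

/-- The algebraic `d`-fold tensor power of `H`: all finite linear combinations of simple tensors.
It is a copy of Mathlib's `⨂[ℝ] _ : Fin d, H`, on which the projective norm is not in force, so
that it can carry the Hilbert space inner product. -/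
def AlgPower (d : ℕ) (H : Type*) [NormedAddCommGroup H] [InnerProductSpace ℝ H] : Type _ :=
  ⨂[ℝ] _ : Fin d, H

section AlgPower

variable {d : ℕ} {H : Type*} [NormedAddCommGroup H] [InnerProductSpace ℝ H]
variable {G : Type*} [NormedAddCommGroup G] [InnerProductSpace ℝ G]

instance : AddCommGroup (AlgPower d H) :=
  inferInstanceAs (AddCommGroup (⨂[ℝ] _ : Fin d, H))

instance : Module ℝ (AlgPower d H) :=
  inferInstanceAs (Module ℝ (⨂[ℝ] _ : Fin d, H))

/-- The simple tensor `x 0 ⊗ ⋯ ⊗ x (d - 1)`. -/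
def AlgPower.tmul (x : Fin d → H) : AlgPower d H := PiTensorProduct.tprod ℝ x

/-- The bilinear form with `⟨⨂ xₗ, ⨂ yₗ⟩ = ∏ ⟨xₗ, yₗ⟩`. -/
def AlgPower.form (d : ℕ) (H : Type*) [NormedAddCommGroup H] [InnerProductSpace ℝ H] :
    AlgPower d H →ₗ[ℝ] AlgPower d H →ₗ[ℝ] ℝ :=
  (PiTensorProduct.dualDistrib (R := ℝ) (M := fun _ : Fin d => H)).comp
    (PiTensorProduct.map (fun _ : Fin d => innerₗ H))

theorem AlgPower.form_tmul (x y : Fin d → H) :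
    AlgPower.form d H (AlgPower.tmul x) (AlgPower.tmul y) = ∏ l, inner ℝ (x l) (y l) := by
  have h : PiTensorProduct.dualDistrib (R := ℝ) (M := fun _ : Fin d => H)
      (PiTensorProduct.map (fun _ : Fin d => innerₗ H) (PiTensorProduct.tprod ℝ x))
      (PiTensorProduct.tprod ℝ y) = ∏ l, inner ℝ (x l) (y l) := by
    rw [PiTensorProduct.map_tprod, PiTensorProduct.dualDistrib_apply]
    rfl
  exact h

theorem AlgPower.exists_eq_sum (t : AlgPower d H) :
    ∃ c : (Fin d → H) →₀ ℝ, c.sum (fun x a => a • AlgPower.tmul x) = t := by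
  have h (u : ⨂[ℝ] _ : Fin d, H) :
      ∃ c : (Fin d → H) →₀ ℝ, c.sum (fun x a => a • PiTensorProduct.tprod ℝ x) = u := by
    rw [← Finsupp.mem_span_range_iff_exists_finsupp, PiTensorProduct.span_tprod_eq_top]
    exact Submodule.mem_top
  exact h t

theorem AlgPower.induction {p : AlgPower d H → Prop} (h0 : p 0)
    (ht : ∀ (a : ℝ) (x : Fin d → H), p (a • AlgPower.tmul x))
    (hadd : ∀ s t, p s → p t → p (s + t)) (t : AlgPower d H) : p t := by
  obtain ⟨c, rfl⟩ := AlgPower.exists_eq_sum t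
  exact Finset.sum_induction _ p hadd h0 fun x _ => ht _ x

theorem AlgPower.hom_ext {E : Type*} [AddCommGroup E] [Module ℝ E] {f g : AlgPower d H →ₗ[ℝ] E}
    (h : ∀ x, f (AlgPower.tmul x) = g (AlgPower.tmul x)) : f = g := by
  ext t
  induction t using AlgPower.induction with
  | h0 => simp
  | ht a x => simp [h]
  | hadd s t hs ht => simp [hs, ht]

theorem AlgPower.form_symm (s t : AlgPower d H) :
    AlgPower.form d H s t = AlgPower.form d H t s := by
  have : AlgPower.form d H = (AlgPower.form d H).flip := by
    refine AlgPower.hom_ext fun x => AlgPower.hom_ext fun y => ?_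
    simp [AlgPower.form_tmul, real_inner_comm]
  exact DFunLike.congr_fun (DFunLike.congr_fun this s) t

/-- The Gram matrix of the simple tensors over a finite set of tensor factors. -/
def gramOn (H : Type*) [NormedAddCommGroup H] [InnerProductSpace ℝ H] {d : ℕ}
    (s : Finset (Fin d)) : Matrix (Fin d → H) (Fin d → H) ℝ :=
  Matrix.of fun x y => ∏ l ∈ s, inner ℝ (x l) (y l)

theorem gramOn_insert {s : Finset (Fin d)} {l : Fin d} (hl : l ∉ s) :
    gramOn H (insert l s) = (Matrix.gram ℝ fun x : Fin d → H => x l).hadamard (gramOn H s) := by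
  ext x y
  simp [gramOn, Finset.prod_insert hl, Matrix.gram]

theorem posSemidef_gram {ι : Type*} (v : ι → H) : (Matrix.gram ℝ v).PosSemidef := by
  refine ⟨Matrix.isHermitian_gram ℝ v, fun c => ?_⟩
  have h : (c.sum fun i a => c.sum fun j b => star a * Matrix.gram ℝ v i j * b) =
      inner ℝ (c.sum fun i a => a • v i) (c.sum fun i a => a • v i) := by
    simp only [Finsupp.sum, sum_inner, inner_sum, inner_smul_left, inner_smul_right,
      Matrix.gram_apply]
    refine Finset.sum_congr rfl fun i _ => ?_
    rw [Finset.mul_sum]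
    refine Finset.sum_congr rfl fun j _ => ?_
    simp only [star_trivial, conj_trivial, real_inner_comm]
    ring
  rw [h]
  exact real_inner_self_nonneg

theorem gramOn_posSemidef (s : Finset (Fin d)) : (gramOn H s).PosSemidef := by
  induction s using Finset.induction_on with
  | empty =>
    have : gramOn H (∅ : Finset (Fin d)) = Matrix.gram ℝ fun _ : Fin d → H => (1 : ℝ) := by
      ext x y; simp [gramOn, Matrix.gram]
    rw [this]
    exact posSemidef_gram _
  | insert l s hl ih =>
    rw [gramOn_insert hl]
    exact (posSemidef_gram _).hadamard ih

theorem AlgPower.form_sum_self (c : (Fin d → H) →₀ ℝ) :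
    AlgPower.form d H (c.sum fun x a => a • AlgPower.tmul x) (c.sum fun x a => a • AlgPower.tmul x)
      = c.sum fun x a => c.sum fun y b => star a * gramOn H Finset.univ x y * b := by
  simp only [Finsupp.sum, map_sum, LinearMap.sum_apply, map_smul, LinearMap.smul_apply,
    AlgPower.form_tmul, smul_eq_mul, gramOn, Matrix.of_apply, star_trivial]
  rw [Finset.sum_comm]
  refine Finset.sum_congr rfl fun x _ => ?_
  rw [Finset.mul_sum]
  refine Finset.sum_congr rfl fun y _ => ?_
  ring

theorem AlgPower.form_self_nonneg (t : AlgPower d H) : 0 ≤ AlgPower.form d H t t := by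
  obtain ⟨c, rfl⟩ := AlgPower.exists_eq_sum t
  rw [AlgPower.form_sum_self]
  exact (gramOn_posSemidef Finset.univ).2 c

instance AlgPower.core : PreInnerProductSpace.Core ℝ (AlgPower d H) where
  inner s t := AlgPower.form d H s t
  conj_inner_symm s t := AlgPower.form_symm t s
  re_inner_nonneg := AlgPower.form_self_nonneg
  add_left s t u := by simp
  smul_left s t a := by simp

instance : SeminormedAddCommGroup (AlgPower d H) :=
  InnerProductSpace.Core.toSeminormedAddCommGroup (𝕜 := ℝ)

instance : InnerProductSpace ℝ (AlgPower d H) := InnerProductSpace.ofCore AlgPower.core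

theorem AlgPower.inner_tmul (x y : Fin d → H) :
    inner ℝ (AlgPower.tmul x) (AlgPower.tmul y) = ∏ l, inner ℝ (x l) (y l) :=
  AlgPower.form_tmul x y

theorem AlgPower.norm_sq (t : AlgPower d H) : ‖t‖ ^ 2 = AlgPower.form d H t t :=
  (real_inner_self_eq_norm_sq t).symm

/-- The algebraic tensor power `S ⊗ ⋯ ⊗ S` of an operator. -/
def AlgPower.map (d : ℕ) (S : H →L[ℝ] G) : AlgPower d H →ₗ[ℝ] AlgPower d G :=
  PiTensorProduct.map (fun _ : Fin d => (S : H →ₗ[ℝ] G))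

theorem AlgPower.map_tmul (S : H →L[ℝ] G) (x : Fin d → H) :
    AlgPower.map d S (AlgPower.tmul x) = AlgPower.tmul fun l => S (x l) :=
  PiTensorProduct.map_tprod _ _

/-- Permutation of the tensor factors, `⨂ xₗ ↦ ⨂ x_{π(l)}`. -/
def AlgPower.perm (π : Equiv.Perm (Fin d)) : AlgPower d H →ₗ[ℝ] AlgPower d H :=
  (PiTensorProduct.reindex ℝ (fun _ : Fin d => H) π.symm).toLinearMap

theorem AlgPower.perm_tmul (π : Equiv.Perm (Fin d)) (x : Fin d → H) :
    AlgPower.perm π (AlgPower.tmul x) = AlgPower.tmul fun l => x (π l) :=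
  PiTensorProduct.reindex_tprod _ _

theorem gramOn_map_posSemidef (S : H →L[ℝ] G) (s : Finset (Fin d)) :
    ((‖S‖ ^ 2) ^ s.card • gramOn H s -
      (gramOn G s).submatrix (fun (x : Fin d → H) l => S (x l)) (fun (x : Fin d → H) l => S (x l))).PosSemidef := by
  induction s using Finset.induction_on with
  | empty =>
    convert Matrix.PosSemidef.zero using 1
    ext x y; simp [gramOn]
  | insert l s hl ih =>
    have h1 := (Matrix.posSemidef_opNorm_smul_gram_sub_gram (fun x : Fin d → H => x l) S).hadamard
      ((gramOn_posSemidef (H := H) s).smul (pow_nonneg (sq_nonneg ‖S‖) s.card))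
    have h2 := (posSemidef_gram fun x : Fin d → H => S (x l)).hadamard ih
    have h3 : (‖S‖ ^ 2) ^ (insert l s).card • gramOn H (insert l s) -
        (gramOn G (insert l s)).submatrix (fun (x : Fin d → H) l => S (x l))
          (fun (x : Fin d → H) l => S (x l)) =
        (‖S‖ ^ 2 • (Matrix.gram ℝ fun x : Fin d → H => x l) -
          Matrix.gram ℝ (S ∘ fun x : Fin d → H => x l)).hadamard
            ((‖S‖ ^ 2) ^ s.card • gramOn H s) +
        (Matrix.gram ℝ fun x : Fin d → H => S (x l)).hadamard
          ((‖S‖ ^ 2) ^ s.card • gramOn H s - (gramOn G s).submatrix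
            (fun (x : Fin d → H) l => S (x l)) (fun (x : Fin d → H) l => S (x l))) := by
      ext x y
      simp [gramOn, Finset.prod_insert hl, Finset.card_insert_of_notMem hl, Matrix.gram]
      ring
    rw [h3]
    exact h1.add h2

theorem AlgPower.norm_map_le (S : H →L[ℝ] G) (t : AlgPower d H) :
    ‖AlgPower.map d S t‖ ≤ ‖S‖ ^ d * ‖t‖ := by
  refine (sq_le_sq₀ (norm_nonneg _) (by positivity)).1 ?_
  rw [mul_pow, ← pow_mul, mul_comm d 2, pow_mul, AlgPower.norm_sq, AlgPower.norm_sq]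
  obtain ⟨c, rfl⟩ := AlgPower.exists_eq_sum t
  have h := (gramOn_map_posSemidef S (Finset.univ : Finset (Fin d))).2 c
  have h1 : AlgPower.form d G (AlgPower.map d S (c.sum fun x a => a • AlgPower.tmul x))
      (AlgPower.map d S (c.sum fun x a => a • AlgPower.tmul x)) =
      c.sum fun x a => c.sum fun y b => star a * (gramOn G Finset.univ).submatrix
        (fun (x : Fin d → H) l => S (x l)) (fun (x : Fin d → H) l => S (x l)) x y * b := by
    simp only [Finsupp.sum, map_sum, LinearMap.sum_apply, map_smul, LinearMap.smul_apply,
      AlgPower.map_tmul, AlgPower.form_tmul, smul_eq_mul, gramOn, Matrix.of_apply, star_trivial,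
      Matrix.submatrix_apply]
    rw [Finset.sum_comm]
    refine Finset.sum_congr rfl fun x _ => ?_
    rw [Finset.mul_sum]
    refine Finset.sum_congr rfl fun y _ => ?_
    ring
  rw [h1, AlgPower.form_sum_self]
  rw [← sub_nonneg]
  refine h.trans_eq ?_
  simp only [Finsupp.sum, Finset.mul_sum, ← Finset.sum_sub_distrib, Matrix.sub_apply,
    Matrix.smul_apply, smul_eq_mul, Finset.card_univ, Fintype.card_fin]
  refine Finset.sum_congr rfl fun x _ => Finset.sum_congr rfl fun y _ => ?_
  ring

theorem AlgPower.norm_perm (π : Equiv.Perm (Fin d)) (t : AlgPower d H) :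
    ‖AlgPower.perm π t‖ = ‖t‖ := by
  have : (AlgPower.form d H).compl₁₂ (AlgPower.perm π) (AlgPower.perm π) = AlgPower.form d H := by
    refine AlgPower.hom_ext fun x => AlgPower.hom_ext fun y => ?_
    simp only [LinearMap.compl₁₂_apply, AlgPower.perm_tmul, AlgPower.form_tmul]
    exact Equiv.prod_comp π fun l => inner ℝ (x l) (y l)
  have h : ‖AlgPower.perm π t‖ ^ 2 = ‖t‖ ^ 2 := by
    rw [AlgPower.norm_sq, AlgPower.norm_sq]
    exact DFunLike.congr_fun (DFunLike.congr_fun this t) t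
  exact (pow_left_inj₀ (norm_nonneg _) (norm_nonneg _) two_ne_zero).1 h

end AlgPower

/-- The Hilbert space tensor power `H ⊗ ⋯ ⊗ H` (`d` factors): the completion of the algebraic
tensor power with respect to `⟨⨂ xₗ, ⨂ yₗ⟩ = ∏ ⟨xₗ, yₗ⟩`. -/
abbrev HilbertPower (d : ℕ) (H : Type*) [NormedAddCommGroup H] [InnerProductSpace ℝ H] : Type _ :=
  UniformSpace.Completion (AlgPower d H)

section HilbertPower

variable {d : ℕ} {H : Type*} [NormedAddCommGroup H] [InnerProductSpace ℝ H]
variable {G : Type*} [NormedAddCommGroup G] [InnerProductSpace ℝ G]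

/-- The simple tensor `x 0 ⊗ ⋯ ⊗ x (d - 1)` in the Hilbert space tensor power. -/
def pureTensor (x : Fin d → H) : HilbertPower d H := (AlgPower.tmul x : AlgPower d H)

theorem inner_pureTensor (x y : Fin d → H) :
    inner ℝ (pureTensor x) (pureTensor y) = ∏ l, inner ℝ (x l) (y l) := by
  rw [pureTensor, pureTensor, UniformSpace.Completion.inner_coe, AlgPower.inner_tmul]

/-- The tensor product operator `S ⊗ ⋯ ⊗ S`, extended to the completion by continuity. -/
def tensorOp (d : ℕ) (S : H →L[ℝ] G) : HilbertPower d H →L[ℝ] HilbertPower d G :=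
  ((AlgPower.map d S).mkContinuous (‖S‖ ^ d) (AlgPower.norm_map_le S)).completion

theorem tensorOp_pureTensor (S : H →L[ℝ] G) (x : Fin d → H) :
    tensorOp d S (pureTensor x) = pureTensor fun l => S (x l) := by
  simp only [tensorOp, pureTensor, ContinuousLinearMap.completion_apply_coe]
  exact congrArg _ (AlgPower.map_tmul S x)

/-- Permutation of the tensor factors, `⨂ xₗ ↦ ⨂ x_{π(l)}`, on the Hilbert space tensor power. -/
def permOp (π : Equiv.Perm (Fin d)) : HilbertPower d H →L[ℝ] HilbertPower d H :=
  ((AlgPower.perm π).mkContinuous 1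
    (fun t => by rw [one_mul]; exact (AlgPower.norm_perm π t).le)).completion

theorem permOp_pureTensor (π : Equiv.Perm (Fin d)) (x : Fin d → H) :
    permOp π (pureTensor x) = pureTensor fun l => x (π l) := by
  simp only [permOp, pureTensor, ContinuousLinearMap.completion_apply_coe]
  exact congrArg _ (AlgPower.perm_tmul π x)

/-- The permutations of the coordinates that leave the complement of `I` fixed. -/
def permsOn (I : Finset (Fin d)) : Finset (Equiv.Perm (Fin d)) :=
  Finset.univ.filter fun π => ∀ l, l ∉ I → π l = l

/-- The symmetrizer with respect to `I`: the average over all permutations of the tensor factors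
in `I`. -/
def symmetrizer (H : Type*) [NormedAddCommGroup H] [InnerProductSpace ℝ H] (I : Finset (Fin d)) :
    HilbertPower d H →L[ℝ] HilbertPower d H :=
  ((permsOn I).card : ℝ)⁻¹ • ∑ π ∈ permsOn I, permOp π

/-- The subspace of `I`-symmetric elements of the tensor power, the image of the symmetrizer. -/
def symSubspace (H : Type*) [NormedAddCommGroup H] [InnerProductSpace ℝ H] (I : Finset (Fin d)) :
    Submodule ℝ (HilbertPower d H) :=
  (symmetrizer H I).range

/-- The `I`-symmetric problem: `S ⊗ ⋯ ⊗ S` restricted to the `I`-symmetric subspace. -/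
def symProblem (S : H →L[ℝ] G) (I : Finset (Fin d)) : symSubspace H I →L[ℝ] HilbertPower d G :=
  (tensorOp d S).comp (symSubspace H I).subtypeL

end HilbertPower

/-! ### Algorithms, minimal errors and information complexity -/

section Complexity

variable {F : Type*} [NormedAddCommGroup F] [NormedSpace ℝ F]
variable {G : Type*} [NormedAddCommGroup G] [NormedSpace ℝ G]

/-- An adaptive information operator: `L v y` is the continuous linear functional that is evaluated
in step `v + 1`, after the values `y 0, …, y (v - 1)` have been obtained. -/
abbrev AdaptiveInfo (F : Type*) [NormedAddCommGroup F] [NormedSpace ℝ F] : Type _ :=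
  (v : ℕ) → (Fin v → ℝ) → (F →L[ℝ] ℝ)

/-- The first `n` values `N(f) = (y 0, …, y (n - 1))` that adaptive information yields at `f`. -/
def AdaptiveInfo.eval (L : AdaptiveInfo F) (f : F) : (n : ℕ) → (Fin n → ℝ)
  | 0 => Fin.elim0
  | n + 1 => Fin.snoc (α := fun _ => ℝ) (L.eval f n) (L n (L.eval f n) f)

/-- The worst case error on the unit ball of an arbitrary map `A` as approximation of `T`. -/
def worstCaseError (T : F →L[ℝ] G) (A : F → G) : ℝ≥0∞ :=
  ⨆ f ∈ Metric.closedBall (0 : F) 1, ‖A f - T f‖ₑ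

/-- The `n`-th minimal worst case error: the infimum over all algorithms `φ ∘ N` where `N` consists
of `n` adaptively chosen continuous linear functionals and `φ` is an arbitrary map. -/
def minimalError (T : F →L[ℝ] G) (n : ℕ) : ℝ≥0∞ :=
  ⨅ (L : AdaptiveInfo F) (φ : (Fin n → ℝ) → G), worstCaseError T fun f => φ (L.eval f n)

/-- The information complexity `n(ε) = min {n | e(n) ≤ ε}` for the absolute error criterion
(`⊤` if there is no such `n`). -/
def infoComplexity (T : F →L[ℝ] G) (ε : ℝ) : ℕ∞ :=
  ⨅ (n : ℕ) (_ : minimalError T n ≤ ENNReal.ofReal ε), (n : ℕ∞)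

/-- `n(ε, d) ≤ C ε⁻ᵖ d^q` for all `d ≥ 1` and `ε ∈ (0, 1]`. -/
def TractabilityBound (n : ℝ → ℕ → ℕ∞) (C p q : ℝ) : Prop :=
  ∀ d : ℕ, 1 ≤ d → ∀ ε : ℝ, 0 < ε → ε ≤ 1 →
    (n ε d : ℝ≥0∞) ≤ ENNReal.ofReal (C * ε ^ (-p) * (d : ℝ) ^ q)

/-- Polynomial tractability of a problem with information complexity `n(ε, d)`. -/
def PolynomiallyTractable (n : ℝ → ℕ → ℕ∞) : Prop :=
  ∃ C p q : ℝ, 0 < C ∧ 0 < p ∧ 0 ≤ q ∧ TractabilityBound n C p q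

/-- Strong polynomial tractability of a problem with information complexity `n(ε, d)`. -/
def StronglyPolynomiallyTractable (n : ℝ → ℕ → ℕ∞) : Prop :=
  ∃ C p : ℝ, 0 < C ∧ 0 < p ∧ TractabilityBound n C p 0

end Complexity

/-- `lam 0 ≥ lam 1 ≥ ⋯ ≥ 0` lists the positive eigenvalues of `W`, each one as often as its
multiplicity says, followed by zeros if there are only finitely many of them. -/
structure IsEigenvalueSeq {H : Type*} [NormedAddCommGroup H] [InnerProductSpace ℝ H]
    (W : H →L[ℝ] H) (lam : ℕ → ℝ) : Prop where
  antitone : Antitone lam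
  nonneg : ∀ m, 0 ≤ lam m
  count : ∀ μ : ℝ, 0 < μ → {m | lam m = μ}.encard =
    Cardinal.toENat (Module.rank ℝ (Module.End.eigenspace (W : H →ₗ[ℝ] H) μ))

end TensorProblem

end

/-!
The squares `mu` of the singular values of `S` determine those of the symmetric problem: averaging
the tensor products of an orthonormal eigenbasis over the permutations of `I_d` gives an orthogonal
basis of the symmetric subspace, indexed by the orbits of index tuples, and the orbit of `j` carries
the square `∏ l, mu (j l)`. Adaption does not help: some unit vector in any subspace of dimension
larger than `n` gives only zeros, and so does its negative. So `e(n, d)` is the `(n + 1)`-st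
singular value and the information complexity counts the singular values above `ε`. By Markov's
inequality, and conversely by the decay that a bound on this count forces, tractability says that
for some `τ > 0` the sum of `∏ l, mu (j l) ^ τ` over the orbits is bounded by `C * d ^ q`.

An orbit is determined by how often each index occurs on `I_d`, where the largest value may be left
out, together with the entries off `I_d`. Hence the sum is at most a product of geometric series,
which grows polynomially in `d` because only finitely many values `mu i ^ τ` exceed `1 / 2`, times
`(∑ i, mu i ^ τ) ^ (d - #I_d)`. Tuples with the entries `λ₁ = 1` and `λ₂` only show that the second
factor cannot be avoided, and, if `λ₂ = 1`, that the sum is at least `#I_d + 1`. If `λ₁ < 1`, or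
`λ₁ = 1 > λ₂`, then a large `τ` makes the sum of all, respectively all but one, of the values
`mu i ^ τ` less than `1 / 2`.
-/

noncomputable section

namespace TensorProblem

section Widths

section Normed

variable {F G : Type*} [NormedAddCommGroup F] [NormedSpace ℝ F]
variable [NormedAddCommGroup G] [NormedSpace ℝ G]

theorem AdaptiveInfo.eval_nonadaptive (ℓ : ℕ → F →L[ℝ] ℝ) (f : F) (n : ℕ) (i : Fin n) :
    AdaptiveInfo.eval (fun v _ => ℓ v) f n i = ℓ i f := by
  induction n with
  | zero => exact i.elim0
  | succ n ih => refine Fin.lastCases ?_ (fun i => ?_) i <;> simp [AdaptiveInfo.eval, ih]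

theorem AdaptiveInfo.eval_eq_zero (L : AdaptiveInfo F) (f : F) {n : ℕ}
    (h : ∀ v < n, L v 0 f = 0) : L.eval f n = 0 := by
  induction n with
  | zero => exact Subsingleton.elim _ _
  | succ n ih =>
    rw [AdaptiveInfo.eval, ih fun v hv => h v (hv.trans n.lt_succ_self), h n n.lt_succ_self]
    ext i
    refine Fin.lastCases ?_ (fun i => ?_) i <;> simp

theorem enorm_sub_le_worstCaseError (T : F →L[ℝ] G) (A : F → G) {f : F} (hf : ‖f‖ ≤ 1) :
    ‖A f - T f‖ₑ ≤ worstCaseError T A :=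
  le_iSup₂ (f := fun (f : F) (_ : f ∈ Metric.closedBall (0 : F) 1) => ‖A f - T f‖ₑ) f (by simpa)

theorem le_worstCaseError_of_map_neg_eq (T : F →L[ℝ] G) {A : F → G} {f : F} (hf : ‖f‖ ≤ 1)
    (hA : A (-f) = A f) : ENNReal.ofReal ‖T f‖ ≤ worstCaseError T A := by
  have htwo : 2 * ‖T f‖ ≤ ‖A f - T (-f)‖ + ‖A f - T f‖ := by
    have h := norm_sub_le (A f - T (-f)) (A f - T f)
    rwa [sub_sub_sub_cancel_left, map_neg, sub_neg_eq_add, ← two_smul ℝ, norm_smul,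
      Real.norm_two, ← map_neg] at h
  have hmax : ‖T f‖ ≤ max ‖A f - T (-f)‖ ‖A f - T f‖ := by
    linarith [le_max_left ‖A f - T (-f)‖ ‖A f - T f‖, le_max_right ‖A f - T (-f)‖ ‖A f - T f‖]
  rcases le_max_iff.1 hmax with h | h <;> refine (ENNReal.ofReal_le_ofReal h).trans ?_ <;>
    rw [ofReal_norm]
  · rw [← hA]
    exact enorm_sub_le_worstCaseError T A (by rwa [norm_neg])
  · exact enorm_sub_le_worstCaseError T A hf

/-- Some unit vector `f ∈ V` is annihilated by all functionals used along the all-zero path, so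
the information cannot tell `f` from `-f`. -/
theorem le_minimalError_of_lt_finrank (T : F →L[ℝ] G) (V : Submodule ℝ F) [FiniteDimensional ℝ V]
    {c : ℝ} (hT : ∀ f ∈ V, c * ‖f‖ ≤ ‖T f‖) {n : ℕ} (hn : n < Module.finrank ℝ V) :
    ENNReal.ofReal c ≤ minimalError T n := by
  refine le_iInf₂ fun L φ => ?_
  let N : V →ₗ[ℝ] (Fin n → ℝ) :=
    LinearMap.pi fun v => ((L v 0 : F →L[ℝ] ℝ) : F →ₗ[ℝ] ℝ) ∘ₗ V.subtype
  obtain ⟨g, hgN, hg0⟩ := Submodule.exists_mem_ne_zero_of_ne_bot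
    (LinearMap.ker_ne_bot_of_finrank_lt (f := N) (by simpa using hn))
  have hpos : 0 < ‖(g : F)‖ := norm_pos_iff.2 fun h => hg0 (Subtype.ext h)
  set f : F := ‖(g : F)‖⁻¹ • g
  have hf : ‖f‖ = 1 := by rw [norm_smul, norm_inv, norm_norm, inv_mul_cancel₀ hpos.ne']
  have hL (v : ℕ) (hv : v < n) : L v 0 f = 0 := by
    have hg : L v 0 g = 0 := congrFun (LinearMap.mem_ker.1 hgN) ⟨v, hv⟩
    rw [map_smul, hg, smul_zero]
  have hc : c ≤ ‖T f‖ := by simpa [hf] using hT f (V.smul_mem _ g.2)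
  refine (ENNReal.ofReal_le_ofReal hc).trans (le_worstCaseError_of_map_neg_eq T hf.le ?_)
  rw [L.eval_eq_zero f hL, L.eval_eq_zero (-f) fun v hv => by rw [map_neg, hL v hv, neg_zero]]

end Normed

variable {F G : Type*} [NormedAddCommGroup F] [InnerProductSpace ℝ F]

theorem minimalError_finrank_le [NormedAddCommGroup G] [NormedSpace ℝ G] (T : F →L[ℝ] G)
    (V : Submodule ℝ F) [FiniteDimensional ℝ V] {ε : ℝ} (hε : 0 ≤ ε)
    (hT : ∀ f ∈ Vᗮ, ‖T f‖ ≤ ε * ‖f‖) :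
    minimalError T (Module.finrank ℝ V) ≤ ENNReal.ofReal ε := by
  let b := stdOrthonormalBasis ℝ V
  let ℓ (v : ℕ) : F →L[ℝ] ℝ :=
    if h : v < Module.finrank ℝ V then innerSL ℝ (b ⟨v, h⟩ : F) else 0
  refine (iInf₂_le (fun v _ => ℓ v) fun y => ∑ i, y i • T (b i)).trans ?_
  refine iSup₂_le fun f hf => ?_
  have hproj : ∑ i, AdaptiveInfo.eval (fun v _ => ℓ v) f _ i • T (b i) =
      T (V.starProjection f) := by
    rw [Submodule.starProjection_apply, b.orthogonalProjectionOnto_apply_eq_sum]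
    simp [AdaptiveInfo.eval_nonadaptive, ℓ]
  have hnorm : ‖f - V.starProjection f‖ ≤ 1 := by
    rw [← Submodule.starProjection_orthogonal_val]
    exact (Vᗮ.norm_starProjection_apply_le f).trans (by simpa using hf)
  beta_reduce
  rw [hproj, enorm_sub_rev, ← ofReal_norm, ← map_sub]
  refine ENNReal.ofReal_le_ofReal ?_
  calc ‖T (f - V.starProjection f)‖ ≤ ε * ‖f - V.starProjection f‖ :=
        hT _ (V.sub_starProjection_mem_orthogonal f)
    _ ≤ ε := mul_le_of_le_one_right hε hnorm

end Widths

theorem finrank_span_image_eq_card {R M ι : Type*} [Ring R] [StrongRankCondition R]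
    [AddCommGroup M] [Module R M] {v : ι → M} (hv : LinearIndependent R v) (A : Finset ι) :
    Module.finrank R (Submodule.span R (v '' A)) = A.card := by
  classical
  have := nontrivial_of_invariantBasisNumber R
  rw [← Finset.coe_image, finrank_span_finset_eq_card,
    Finset.card_image_of_injective _ hv.injective]
  simpa using hv.linearIndepOn_id.mono (Set.image_subset_range v A)

section SingularSystem

variable {ι F G : Type*} [NormedAddCommGroup F] [InnerProductSpace ℝ F]
variable [NormedAddCommGroup G] [InnerProductSpace ℝ G]

theorem hasSum_inner_hilbertBasis_sq (b : HilbertBasis ι ℝ F) (f : F) :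
    HasSum (fun i => inner ℝ (b i) f ^ 2) (‖f‖ ^ 2) := by
  rw [← real_inner_self_eq_norm_sq]
  simpa only [real_inner_comm f, ← sq] using b.hasSum_inner_mul_inner f f

/-- The Hilbert basis `b` diagonalizes `T† T`, with eigenvalues `mu`, the squared singular values
of `T`. The equations `T† T (b i) = mu i • b i` are tested against the basis, which avoids the
adjoint and so asks nothing of `G`. -/
def IsSingularSystem (T : F →L[ℝ] G) (b : HilbertBasis ι ℝ F) (mu : ι → ℝ) : Prop :=
  ∀ i j, inner ℝ (T (b i)) (T (b j)) = mu i * inner ℝ (b i) (b j)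

namespace IsSingularSystem

variable {T : F →L[ℝ] G} {b : HilbertBasis ι ℝ F} {mu : ι → ℝ}

theorem nonneg (h : IsSingularSystem T b mu) (i : ι) : 0 ≤ mu i := by
  have hself := h i i
  rw [real_inner_self_eq_norm_sq (b i), b.orthonormal.1 i, one_pow, mul_one] at hself
  exact hself ▸ real_inner_self_nonneg

theorem inner_map_map (h : IsSingularSystem T b mu) (i : ι) (f : F) :
    inner ℝ (T (b i)) (T f) = mu i * inner ℝ (b i) f := by
  have heq : innerSL ℝ (T (b i)) ∘L T = mu i • innerSL ℝ (b i) :=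
    ContinuousLinearMap.ext_on (Submodule.dense_iff_topologicalClosure_eq_top.2 b.dense_span)
      (Set.forall_mem_range.2 fun j => by simpa using h i j)
  simpa using DFunLike.congr_fun heq f

theorem hasSum_norm_map_sq (h : IsSingularSystem T b mu) (f : F) :
    HasSum (fun i => mu i * inner ℝ (b i) f ^ 2) (‖T f‖ ^ 2) := by
  have hT := ((b.hasSum_repr f).mapL T).mapL (innerSL ℝ (T f))
  rw [innerSL_apply_apply, real_inner_self_eq_norm_sq] at hT
  convert! hT using 2 with i
  rw [map_smul, map_smul, innerSL_apply_apply, real_inner_comm (T (b i)), h.inner_map_map,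
    b.repr_apply_apply, smul_eq_mul]
  ring

theorem norm_map_le (h : IsSingularSystem T b mu) {ε : ℝ} (hε : 0 ≤ ε) {f : F}
    (hf : ∀ i, ε ^ 2 < mu i → inner ℝ (b i) f = 0) : ‖T f‖ ≤ ε * ‖f‖ := by
  refine (sq_le_sq₀ (norm_nonneg _) (by positivity)).1 ?_
  rw [mul_pow]
  refine hasSum_le (fun i => ?_) (h.hasSum_norm_map_sq f)
    ((hasSum_inner_hilbertBasis_sq b f).mul_left _)
  rcases le_or_gt (mu i) (ε ^ 2) with hi | hi
  · gcongr
  · simp [hf i hi]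

theorem le_norm_map (h : IsSingularSystem T b mu) {c : ℝ} (hc : 0 ≤ c) {f : F}
    (hf : ∀ i, mu i < c ^ 2 → inner ℝ (b i) f = 0) : c * ‖f‖ ≤ ‖T f‖ := by
  refine (sq_le_sq₀ (by positivity) (norm_nonneg _)).1 ?_
  rw [mul_pow]
  refine hasSum_le (fun i => ?_) ((hasSum_inner_hilbertBasis_sq b f).mul_left _)
    (h.hasSum_norm_map_sq f)
  rcases lt_or_ge (mu i) (c ^ 2) with hi | hi
  · simp [hf i hi]
  · gcongr

theorem infoComplexity_le_encard (h : IsSingularSystem T b mu) {ε : ℝ} (hε : 0 ≤ ε) :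
    infoComplexity T ε ≤ {i | ε ^ 2 < mu i}.encard := by
  rcases Set.finite_or_infinite {i | ε ^ 2 < mu i} with hfin | hinf
  · lift {i | ε ^ 2 < mu i} to Finset ι using hfin with A hA
    have hmem (i : ι) : i ∈ A ↔ ε ^ 2 < mu i := by rw [← Finset.mem_coe, hA, Set.mem_ofPred_eq]
    have := FiniteDimensional.span_of_finite ℝ (A.finite_toSet.image b)
    have herr := minimalError_finrank_le T (Submodule.span ℝ (b '' A)) hε fun f hf =>
      h.norm_map_le hε fun i hi => (Submodule.mem_orthogonal _ _).1 hf _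
        (Submodule.subset_span (Set.mem_image_of_mem b ((hmem i).2 hi)))
    rw [finrank_span_image_eq_card b.orthonormal.linearIndependent] at herr
    rw [Set.encard_coe_eq_coe_finsetCard]
    exact iInf₂_le A.card herr
  · simp [hinf.encard_eq]

theorem encard_le_infoComplexity (h : IsSingularSystem T b mu) {ε : ℝ} (hε : 0 ≤ ε) :
    {i | ε ^ 2 < mu i}.encard ≤ infoComplexity T ε := by
  refine le_iInf₂ fun n hn => ?_
  by_contra! hlt
  obtain ⟨A, hA, hcard⟩ := Set.exists_subset_encard_eq (Order.add_one_le_of_lt hlt)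
  lift A to Finset ι using Set.finite_of_encard_eq_coe hcard
  rw [Set.encard_coe_eq_coe_finsetCard] at hcard
  have hcard' : A.card = n + 1 := by exact_mod_cast hcard
  obtain ⟨m, hm, hmin⟩ := A.exists_min_image mu (Finset.card_pos.1 (by omega))
  have hεm : ε < √(mu m) := Real.lt_sqrt_of_sq_lt (hA hm)
  have := FiniteDimensional.span_of_finite ℝ (A.finite_toSet.image b)
  have herr : ENNReal.ofReal √(mu m) ≤ minimalError T n := by
    refine le_minimalError_of_lt_finrank T (Submodule.span ℝ (b '' A)) (fun f hf => ?_)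
      (by rw [finrank_span_image_eq_card b.orthonormal.linearIndependent]; omega)
    refine h.le_norm_map (Real.sqrt_nonneg _) fun i hi => ?_
    rw [Real.sq_sqrt (h.nonneg m)] at hi
    have hspan : Submodule.span ℝ (b '' A) ≤ (ℝ ∙ b i)ᗮ :=
      Submodule.span_le.2 <| Set.forall_mem_image.2 fun j hj =>
        Submodule.mem_orthogonal_singleton_iff_inner_right.2 <|
          b.orthonormal.2 (ne_of_apply_ne mu (hi.trans_le (hmin j hj)).ne)
    exact Submodule.mem_orthogonal_singleton_iff_inner_right.1 (hspan hf)
  exact hεm.not_ge ((ENNReal.ofReal_le_ofReal_iff hε).1 (herr.trans hn))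

theorem infoComplexity_eq (h : IsSingularSystem T b mu) {ε : ℝ} (hε : 0 ≤ ε) :
    infoComplexity T ε = {i | ε ^ 2 < mu i}.encard :=
  (h.infoComplexity_le_encard hε).antisymm (h.encard_le_infoComplexity hε)

end IsSingularSystem

end SingularSystem

section Criterion

theorem encard_lt_le_of_sum_rpow_le {ι : Type*} {x : ι → ℝ} {τ D : ℝ} (hτ : 0 ≤ τ)
    (hD : ∀ s : Finset ι, ∑ i ∈ s, x i ^ τ ≤ D) {δ : ℝ} (hδ : 0 < δ) :
    ({i | δ < x i}.encard : ℝ≥0∞) ≤ ENNReal.ofReal (D * δ ^ (-τ)) := by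
  have hD0 : 0 ≤ D := by simpa using hD ∅
  have hfloor : {i | δ < x i}.encard ≤ ⌊D * δ ^ (-τ)⌋₊ := by
    by_contra! hlt
    obtain ⟨s, hs, hcard⟩ := Set.exists_subset_encard_eq (Order.add_one_le_of_lt hlt)
    lift s to Finset ι using Set.finite_of_encard_eq_coe hcard
    rw [Set.encard_coe_eq_coe_finsetCard] at hcard
    have hmarkov : s.card * δ ^ τ ≤ D := by
      rw [← nsmul_eq_mul]
      refine le_trans (Finset.card_nsmul_le_sum s _ _ fun i hi => ?_) (hD s)
      exact Real.rpow_le_rpow hδ.le (hs hi).le hτ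
    have hle : (s.card : ℝ) ≤ D * δ ^ (-τ) := by
      rwa [Real.rpow_neg hδ.le, ← div_eq_mul_inv, le_div_iff₀ (by positivity)]
    have hle' := Nat.le_floor hle
    have hcard' : s.card = ⌊D * δ ^ (-τ)⌋₊ + 1 := by exact_mod_cast hcard
    omega
  calc ({i | δ < x i}.encard : ℝ≥0∞) ≤ ((⌊D * δ ^ (-τ)⌋₊ : ℕ∞) : ℝ≥0∞) := by exact_mod_cast hfloor
    _ = (⌊D * δ ^ (-τ)⌋₊ : ℝ≥0∞) := by simp
    _ ≤ ENNReal.ofReal (D * δ ^ (-τ)) := by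
      rw [← ENNReal.ofReal_natCast]
      exact ENNReal.ofReal_le_ofReal (Nat.floor_le (by positivity))

theorem sum_le_of_exists_card_sq_mul_le {ι : Type*} {x : ι → ℝ} {M : ℝ} (hM : 0 ≤ M)
    (h : ∀ s : Finset ι, s.Nonempty → ∃ i ∈ s, (s.card : ℝ) ^ 2 * x i ≤ M) (s : Finset ι) :
    ∑ i ∈ s, x i ≤ 2 * M := by
  classical
  -- the induction telescopes `1 / n² ≤ 1 / (n - 1/2) - 1 / (n + 1/2)`
  suffices hs : ∑ i ∈ s, x i ≤ M * (2 - 1 / (s.card + 1 / 2)) by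
    refine hs.trans ?_
    rw [mul_comm 2 M]
    gcongr
    exact sub_le_self _ (by positivity)
  induction hn : s.card generalizing s with
  | zero => simp [Finset.card_eq_zero.1 hn]
  | succ n ih =>
    obtain ⟨i, hi, hix⟩ := h s (Finset.card_pos.1 (by omega))
    have herase := ih (s.erase i) (by rw [Finset.card_erase_of_mem hi, hn, Nat.add_sub_cancel])
    have htelescope : 1 / ((n : ℝ) + 1) ^ 2 ≤ 1 / (n + 1 / 2) - 1 / (n + 1 + 1 / 2) := by
      rw [div_sub_div _ _ (by positivity) (by positivity), div_le_div_iff₀ (by positivity)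
        (by positivity)]
      nlinarith
    have hxi : x i ≤ M * (1 / (n + 1 / 2) - 1 / (n + 1 + 1 / 2)) := by
      rw [hn, Nat.cast_succ, ← le_div_iff₀' (by positivity), div_eq_mul_one_div] at hix
      exact hix.trans (by gcongr)
    rw [← Finset.add_sum_erase s x hi, Nat.cast_succ]
    linarith

theorem sum_rpow_le_of_encard_lt_le {ι : Type*} {x : ι → ℝ} {K p : ℝ} (hp : 0 < p)
    (h0 : ∀ i, 0 ≤ x i) (h1 : ∀ i, x i ≤ 1)
    (hK : ∀ ε : ℝ, 0 < ε → ε ≤ 1 →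
      ({i | ε ^ 2 < x i}.encard : ℝ≥0∞) ≤ ENNReal.ofReal (K * ε ^ (-p))) (s : Finset ι) :
    ∑ i ∈ s, x i ^ p ≤ 2 * (K * 2 ^ p) ^ 2 := by
  refine sum_le_of_exists_card_sq_mul_le (sq_nonneg _) (fun t ht => ?_) s
  obtain ⟨m, hm, hmin⟩ := t.exists_min_image x ht
  refine ⟨m, hm, ?_⟩
  rcases (h0 m).eq_or_lt with hzero | hpos
  · rw [← hzero, Real.zero_rpow hp.ne', mul_zero]
    positivity
  · have hr : 0 < √(x m) := Real.sqrt_pos.2 hpos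
    have hr1 : √(x m) ≤ 1 := Real.sqrt_le_one.2 (h1 m)
    have hsub : (t : Set ι) ⊆ {i | (√(x m) / 2) ^ 2 < x i} := fun i hi => by
      rw [Set.mem_ofPred_eq, div_pow, Real.sq_sqrt (h0 m)]
      linarith [hmin i hi]
    have hcard : (t.card : ℝ) ≤ K * (√(x m) / 2) ^ (-p) := by
      have hle := hK _ (half_pos hr) (by linarith)
      have hle' : ((t.card : ℕ∞) : ℝ≥0∞) ≤ ENNReal.ofReal (K * (√(x m) / 2) ^ (-p)) := by
        refine le_trans ?_ hle
        rw [← Set.encard_coe_eq_coe_finsetCard]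
        exact_mod_cast Set.encard_le_encard hsub
      rwa [ENat.toENNReal_coe, ENNReal.natCast_le_ofReal (Finset.card_ne_zero.2 ht)] at hle'
    have hroot : (t.card : ℝ) * √(x m) ^ p ≤ K * 2 ^ p := by
      rw [Real.rpow_neg (by positivity), Real.div_rpow hr.le zero_le_two, inv_div,
        ← mul_div_assoc, le_div_iff₀ (by positivity)] at hcard
      exact hcard
    calc (t.card : ℝ) ^ 2 * x m ^ p = (t.card * √(x m) ^ p) ^ 2 := by
          rw [mul_pow, ← Real.rpow_mul_natCast hr.le, mul_comm p, Real.rpow_mul hr.le,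
            Real.rpow_natCast, Real.sq_sqrt (h0 m)]
      _ ≤ (K * 2 ^ p) ^ 2 := by gcongr

variable {ι F G : ℕ → Type*}
variable [∀ d, NormedAddCommGroup (F d)] [∀ d, InnerProductSpace ℝ (F d)]
variable [∀ d, NormedAddCommGroup (G d)] [∀ d, InnerProductSpace ℝ (G d)]
variable {T : ∀ d, F d →L[ℝ] G d} {b : ∀ d, HilbertBasis (ι d) ℝ (F d)} {mu : ∀ d, ι d → ℝ}

theorem tractabilityBound_of_sum_rpow_le (hT : ∀ d, IsSingularSystem (T d) (b d) (mu d))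
    {C τ q : ℝ} (hτ : 0 ≤ τ)
    (hC : ∀ d, 1 ≤ d → ∀ s : Finset (ι d), ∑ i ∈ s, mu d i ^ τ ≤ C * d ^ q) :
    TractabilityBound (fun ε d => infoComplexity (T d) ε) C (2 * τ) q := by
  intro d hd ε hε _
  have hcard := encard_lt_le_of_sum_rpow_le hτ (hC d hd) (pow_pos hε 2)
  have hpow : (ε ^ 2) ^ (-τ) = ε ^ (-(2 * τ)) := by
    rw [← mul_neg, Real.rpow_mul hε.le, Real.rpow_ofNat]
  rwa [hpow, mul_right_comm, ← (hT d).infoComplexity_eq hε.le] at hcard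

theorem TractabilityBound.sum_rpow_le (hT : ∀ d, IsSingularSystem (T d) (b d) (mu d))
    (h1 : ∀ d i, mu d i ≤ 1) {C p q : ℝ} (hp : 0 < p)
    (h : TractabilityBound (fun ε d => infoComplexity (T d) ε) C p q) {d : ℕ} (hd : 1 ≤ d)
    (s : Finset (ι d)) : ∑ i ∈ s, mu d i ^ p ≤ 2 * (C * 2 ^ p) ^ 2 * d ^ (2 * q) := by
  have hsum := sum_rpow_le_of_encard_lt_le (K := C * d ^ q) hp (hT d).nonneg (h1 d)
    (fun ε hε hε1 => by
      rw [← (hT d).infoComplexity_eq hε.le, mul_right_comm]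
      exact h d hd ε hε hε1) s
  refine hsum.trans_eq ?_
  rw [mul_comm 2 q, Real.rpow_mul d.cast_nonneg, Real.rpow_ofNat]
  ring

theorem polynomiallyTractable_iff_sum_rpow_le (hT : ∀ d, IsSingularSystem (T d) (b d) (mu d))
    (h1 : ∀ d i, mu d i ≤ 1) :
    PolynomiallyTractable (fun ε d => infoComplexity (T d) ε) ↔
      ∃ τ C q : ℝ, 0 < τ ∧ 0 < C ∧ 0 ≤ q ∧
        ∀ d, 1 ≤ d → ∀ s : Finset (ι d), ∑ i ∈ s, mu d i ^ τ ≤ C * d ^ q := by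
  constructor
  · rintro ⟨C, p, q, hC, hp, hq, h⟩
    exact ⟨p, 2 * (C * 2 ^ p) ^ 2, 2 * q, hp, by positivity, by positivity,
      fun d hd => h.sum_rpow_le hT h1 hp hd⟩
  · rintro ⟨τ, C, q, hτ, hC, hq, h⟩
    exact ⟨C, 2 * τ, q, hC, by positivity, hq, tractabilityBound_of_sum_rpow_le hT hτ.le h⟩

theorem stronglyPolynomiallyTractable_iff_sum_rpow_le
    (hT : ∀ d, IsSingularSystem (T d) (b d) (mu d)) (h1 : ∀ d i, mu d i ≤ 1) :
    StronglyPolynomiallyTractable (fun ε d => infoComplexity (T d) ε) ↔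
      ∃ τ C : ℝ, 0 < τ ∧ 0 < C ∧
        ∀ d, 1 ≤ d → ∀ s : Finset (ι d), ∑ i ∈ s, mu d i ^ τ ≤ C := by
  constructor
  · rintro ⟨C, p, hC, hp, h⟩
    exact ⟨p, 2 * (C * 2 ^ p) ^ 2, hp, by positivity,
      fun d hd s => by simpa using h.sum_rpow_le hT h1 hp hd s⟩
  · rintro ⟨τ, C, hτ, hC, h⟩
    exact ⟨C, 2 * τ, hC, by positivity,
      tractabilityBound_of_sum_rpow_le hT hτ.le fun d hd s => by simpa using h d hd s⟩

end Criterion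

section Spectral

theorem span_sigma_orthogonal_eq_bot {𝕜 H α : Type*} [RCLike 𝕜] [NormedAddCommGroup H]
    [InnerProductSpace 𝕜 H] {V : α → Submodule 𝕜 H} (hbot : (⨆ r, V r)ᗮ = ⊥) {w : α → Type*}
    (c : ∀ r, HilbertBasis (w r) 𝕜 (V r)) :
    (Submodule.span 𝕜 (Set.range fun a : Σ r, w r => (c a.1 a.2 : H)))ᗮ = ⊥ := by
  rw [eq_bot_iff, ← hbot, ← Submodule.iInf_orthogonal]
  intro y hy
  refine (Submodule.mem_iInf _).2 fun r => (Submodule.mem_orthogonal' _ _).2 fun x hx => ?_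
  have hzero : innerSL 𝕜 y ∘L (V r).subtypeL = 0 :=
    ContinuousLinearMap.ext_on (Submodule.dense_iff_topologicalClosure_eq_top.2 (c r).dense_span)
      (Set.forall_mem_range.2 fun i =>
        (Submodule.mem_orthogonal' _ _).1 hy _ (Submodule.subset_span ⟨⟨r, i⟩, rfl⟩))
  exact DFunLike.congr_fun hzero ⟨x, hx⟩

theorem card_hilbertBasis_index {𝕜 ι E : Type*} [RCLike 𝕜] [NormedAddCommGroup E]
    [InnerProductSpace 𝕜 E] [FiniteDimensional 𝕜 E] (b : HilbertBasis ι 𝕜 E) :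
    ENat.card ι = Cardinal.toENat (Module.rank 𝕜 E) := by
  have : Finite ι := b.orthonormal.linearIndependent.finite
  have := Fintype.ofFinite ι
  rw [rank_eq_card_basis b.toOrthonormalBasis.toBasis]
  simp

universe u

theorem exists_hilbertBasis_eigenvectors {H : Type u} [NormedAddCommGroup H]
    [InnerProductSpace ℝ H] [CompleteSpace H] {W : H →L[ℝ] H} (hW : IsCompactOperator W)
    (hsymm : (W : H →ₗ[ℝ] H).IsSymmetric) :
    ∃ (ι : Type u) (b : HilbertBasis ι ℝ H) (mu : ι → ℝ), (∀ i, W (b i) = mu i • b i) ∧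
      ∀ r, r ≠ 0 → {i | mu i = r}.Finite ∧ {i | mu i = r}.encard =
        Cardinal.toENat (Module.rank ℝ (Module.End.eigenspace (W : H →ₗ[ℝ] H) r)) := by
  let V (r : ℝ) := Module.End.eigenspace (W : H →ₗ[ℝ] H) r
  have hcomplete (r : ℝ) : CompleteSpace (V r) :=
    (ContinuousLinearMap.isClosed_eigenspace W r).completeSpace_coe
  choose w c _ using fun r => exists_hilbertBasis ℝ (V r)
  have horth : Orthonormal ℝ fun a : Σ r, w r => (c a.1 a.2 : H) :=
    hsymm.orthogonalFamily_eigenspaces.orthonormal_sigma_orthonormal fun r => (c r).orthonormal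
  refine ⟨Σ r, w r, HilbertBasis.mkOfOrthogonalEqBot horth (span_sigma_orthogonal_eq_bot
    (ContinuousLinearMap.orthogonalComplement_iSup_eigenspaces_eq_bot hW hsymm) c),
    Sigma.fst, fun a => ?_, fun r hr => ?_⟩
  · rw [HilbertBasis.coe_mkOfOrthogonalEqBot]
    exact Module.End.mem_eigenspace_iff.1 (c a.1 a.2).2
  · have := ContinuousLinearMap.finite_dimensional_eigenspace hW r hr
    have : Finite (w r) := (c r).orthonormal.linearIndependent.finite
    exact ⟨Finite.of_equiv _ (Equiv.sigmaSubtype r).symm,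
      (ENat.card_congr (Equiv.sigmaSubtype r)).trans (card_hilbertBasis_index (c r))⟩

theorem exists_equiv_of_encard_fiber_eq {α β γ : Type*} {f : α → γ} {g : β → γ} {p : γ → Prop}
    (hfin : ∀ c, p c → {a | f a = c}.Finite)
    (hcard : ∀ c, p c → {b | g b = c}.encard = {a | f a = c}.encard) :
    ∃ φ : {a // p (f a)} ≃ {b // p (g b)}, ∀ a, g (φ a) = f a := by
  have hfiber (c : Subtype p) : Nonempty ({a : {a // p (f a)} // (⟨f a, a.2⟩ : Subtype p) = c} ≃
      {b : {b // p (g b)} // (⟨g b, b.2⟩ : Subtype p) = c}) := by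
    obtain ⟨c, hc⟩ := c
    have hfinα : Finite {a // f a = c} := hfin c hc
    have hfinβ : Finite {b // g b = c} :=
      Set.encard_ne_top_iff.1 (hcard c hc ▸ (hfin c hc).encard_lt_top.ne)
    obtain ⟨e⟩ : Nonempty ({a // f a = c} ≃ {b // g b = c}) :=
      Finite.card_eq.1 (congrArg ENat.toNat (hcard c hc)).symm
    simp only [Subtype.mk.injEq]
    exact ⟨(Equiv.subtypeSubtypeEquivSubtype (fun h => h ▸ hc)).trans <|
      e.trans (Equiv.subtypeSubtypeEquivSubtype (fun h => h ▸ hc)).symm⟩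
  refine ⟨Equiv.ofFiberEquiv fun c => (hfiber c).some, fun a => ?_⟩
  exact congrArg Subtype.val (Equiv.ofFiberEquiv_map (fun c => (hfiber c).some) a)

theorem exists_isSingularSystem {H : Type u} {G : Type*}
    [NormedAddCommGroup H] [InnerProductSpace ℝ H] [CompleteSpace H]
    [NormedAddCommGroup G] [InnerProductSpace ℝ G] [CompleteSpace G]
    {S : H →L[ℝ] G} (hS : IsCompactOperator S)
    {lam : ℕ → ℝ} (hlam : IsEigenvalueSeq (S.adjoint ∘L S) lam) :
    ∃ (ι : Type u) (b : HilbertBasis ι ℝ H) (mu : ι → ℝ), IsSingularSystem S b mu ∧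
      ∃ φ : {i // 0 < mu i} ≃ {m // 0 < lam m}, ∀ i, lam (φ i) = mu i := by
  obtain ⟨ι, b, mu, hb, hcard⟩ := exists_hilbertBasis_eigenvectors (hS.clm_comp S.adjoint)
    S.isPositive_adjoint_comp_self.isSymmetric
  refine ⟨ι, b, mu, fun i j => ?_, exists_equiv_of_encard_fiber_eq
    (fun r hr => (hcard r hr.ne').1) fun r hr => (hlam.count r hr).trans (hcard r hr.ne').2.symm⟩
  rw [← ContinuousLinearMap.adjoint_inner_left, ← ContinuousLinearMap.comp_apply, hb,
    real_inner_smul_left]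

theorem summable_rpow_subtype_pos_iff {α : Type*} {x : α → ℝ} (h0 : ∀ a, 0 ≤ x a) {τ : ℝ}
    (hτ : 0 < τ) : Summable (fun a : {a // 0 < x a} => x a ^ τ) ↔ Summable fun a => x a ^ τ := by
  refine Subtype.val_injective.summable_iff (f := fun a => x a ^ τ) fun a ha => ?_
  have hzero : x a = 0 := (h0 a).antisymm' (not_lt.1 (by simpa using ha))
  rw [hzero, Real.zero_rpow hτ.ne']

variable {ι : Type*} {mu : ι → ℝ} {lam : ℕ → ℝ}

theorem summable_rpow_iff_of_equiv_pos (hmu : ∀ i, 0 ≤ mu i) (hlam : ∀ m, 0 ≤ lam m)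
    (φ : {i // 0 < mu i} ≃ {m // 0 < lam m}) (hφ : ∀ i, lam (φ i) = mu i) {τ : ℝ} (hτ : 0 < τ) :
    (Summable fun m => lam m ^ τ) ↔ Summable fun i => mu i ^ τ := by
  rw [← summable_rpow_subtype_pos_iff hmu hτ, ← summable_rpow_subtype_pos_iff hlam hτ,
    ← φ.summable_iff]
  simp only [Function.comp_def, hφ]

theorem exists_two_largest_of_equiv_pos (hlam : Antitone lam) (hpos : 0 < lam 1)
    (φ : {i // 0 < mu i} ≃ {m // 0 < lam m}) (hφ : ∀ i, lam (φ i) = mu i) :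
    ∃ i₀ i₁, i₀ ≠ i₁ ∧ mu i₀ = lam 0 ∧ mu i₁ = lam 1 ∧
      (∀ i, mu i ≤ mu i₀) ∧ ∀ i ≠ i₀, mu i ≤ mu i₁ := by
  have hpos₀ : 0 < lam 0 := hpos.trans_le (hlam zero_le_one)
  have hφ_symm (m) (hm : 0 < lam m) : mu (φ.symm ⟨m, hm⟩) = lam m := by
    rw [← hφ, Equiv.apply_symm_apply]
  refine ⟨φ.symm ⟨0, hpos₀⟩, φ.symm ⟨1, hpos⟩, fun h => ?_, hφ_symm 0 hpos₀, hφ_symm 1 hpos,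
    fun i => ?_, fun i hi => ?_⟩
  · simpa using φ.symm.injective (Subtype.ext h)
  · rw [hφ_symm]
    rcases le_or_gt (mu i) 0 with h | h
    · exact h.trans hpos₀.le
    · exact hφ ⟨i, h⟩ ▸ hlam (Nat.zero_le _)
  · rw [hφ_symm]
    rcases le_or_gt (mu i) 0 with h | h
    · exact h.trans hpos.le
    · refine hφ ⟨i, h⟩ ▸ hlam (Nat.one_le_iff_ne_zero.2 fun h₀ => hi ?_)
      have hφ₀ : φ ⟨i, h⟩ = ⟨0, hpos₀⟩ := Subtype.ext h₀
      rw [← hφ₀, φ.symm_apply_apply]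

end Spectral

section Orthogonal

variable {ι F G : Type*} [NormedAddCommGroup F] [InnerProductSpace ℝ F] [CompleteSpace F]
variable [NormedAddCommGroup G] [InnerProductSpace ℝ G]

theorem exists_isSingularSystem_of_orthogonal {T : F →L[ℝ] G} {v : ι → F} {mu : ι → ℝ}
    (hne : ∀ i, v i ≠ 0) (horth : Pairwise fun i j => inner ℝ (v i) (v j) = 0)
    (htotal : ∀ f, (∀ i, inner ℝ (v i) f = 0) → f = 0)
    (hT : ∀ i f, inner ℝ (T (v i)) (T f) = mu i * inner ℝ (v i) f) :
    ∃ b : HilbertBasis ι ℝ F, IsSingularSystem T b mu := by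
  have hon : Orthonormal ℝ fun i => ‖v i‖⁻¹ • v i := by
    refine ⟨fun i => norm_smul_inv_norm (𝕜 := ℝ) (hne i), fun i j hij => ?_⟩
    simp only [inner_smul_left, inner_smul_right, horth hij, mul_zero]
  have hbot : (Submodule.span ℝ (Set.range fun i => ‖v i‖⁻¹ • v i))ᗮ = ⊥ := by
    refine (Submodule.eq_bot_iff _).2 fun f hf => htotal f fun i => ?_
    have h0 := hf (‖v i‖⁻¹ • v i) (Submodule.subset_span ⟨i, rfl⟩)
    rwa [real_inner_smul_left, mul_eq_zero, or_iff_right (by simp [hne])] at h0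
  refine ⟨HilbertBasis.mkOfOrthogonalEqBot hon hbot, fun i j => ?_⟩
  rw [HilbertBasis.coe_mkOfOrthogonalEqBot, map_smul, real_inner_smul_left, hT,
    real_inner_smul_left, mul_left_comm]

end Orthogonal

section TensorBasis

variable {d : ℕ} {H : Type*} [NormedAddCommGroup H] [InnerProductSpace ℝ H]
variable {G : Type*} [NormedAddCommGroup G] [InnerProductSpace ℝ G]
variable {ι : Type*} {b : HilbertBasis ι ℝ H} {mu : ι → ℝ}

theorem norm_pureTensor (x : Fin d → H) : ‖pureTensor x‖ = ∏ l, ‖x l‖ := by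
  refine (pow_left_inj₀ (norm_nonneg _) (Finset.prod_nonneg fun _ _ => norm_nonneg _)
    two_ne_zero).1 ?_
  rw [← real_inner_self_eq_norm_sq, inner_pureTensor, ← Finset.prod_pow]
  simp

theorem pureTensor_update_add (x : Fin d → H) (l : Fin d) (u v : H) :
    pureTensor (Function.update x l (u + v)) =
      pureTensor (Function.update x l u) + pureTensor (Function.update x l v) := by
  rw [pureTensor, pureTensor, pureTensor, ← UniformSpace.Completion.coe_add]
  exact congrArg _ ((PiTensorProduct.tprod ℝ).map_update_add x l u v)

theorem pureTensor_update_smul (x : Fin d → H) (l : Fin d) (a : ℝ) (u : H) :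
    pureTensor (Function.update x l (a • u)) = a • pureTensor (Function.update x l u) := by
  rw [pureTensor, pureTensor, ← UniformSpace.Completion.coe_smul]
  exact congrArg _ ((PiTensorProduct.tprod ℝ).map_update_smul x l a u)

/-- The linear functional `u ↦ ⟨y, x 0 ⊗ ⋯ ⊗ u ⊗ ⋯ ⊗ x (d - 1)⟩`. -/
def slotFunctional (y : HilbertPower d H) (x : Fin d → H) (l : Fin d) : H →L[ℝ] ℝ :=
  LinearMap.mkContinuous
    { toFun := fun u => inner ℝ y (pureTensor (Function.update x l u))
      map_add' := fun u v => by rw [pureTensor_update_add, inner_add_right]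
      map_smul' := fun a u => by
        rw [pureTensor_update_smul, inner_smul_right, RingHom.id_apply, smul_eq_mul] }
    (‖y‖ * ∏ k ∈ Finset.univ.erase l, ‖x k‖) (fun u => by
      refine (norm_inner_le_norm (𝕜 := ℝ) y (pureTensor (Function.update x l u))).trans ?_
      rw [norm_pureTensor, ← Finset.mul_prod_erase _ _ (Finset.mem_univ l), Function.update_self,
        Finset.prod_congr rfl fun k hk => by rw [Function.update_of_ne (Finset.ne_of_mem_erase hk)]]
      exact le_of_eq (by ring))

theorem slotFunctional_apply (y : HilbertPower d H) (x : Fin d → H) (l : Fin d) (u : H) :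
    slotFunctional y x l u = inner ℝ y (pureTensor (Function.update x l u)) := rfl

theorem ext_of_pureTensor {E : Type*} [NormedAddCommGroup E] [NormedSpace ℝ E]
    {A B : HilbertPower d H →L[ℝ] E} (h : ∀ x, A (pureTensor x) = B (pureTensor x)) : A = B := by
  ext y
  induction y using UniformSpace.Completion.induction_on with
  | hp => exact isClosed_eq A.continuous B.continuous
  | ih t =>
    induction t using AlgPower.induction with
    | h0 => rw [UniformSpace.Completion.coe_zero, map_zero, map_zero]
    | ht a x =>
      rw [UniformSpace.Completion.coe_smul, map_smul, map_smul]
      exact congrArg _ (h x)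
    | hadd s t hs ht =>
      rw [UniformSpace.Completion.coe_add, map_add, map_add, hs, ht]

theorem inner_pureTensor_eq_zero_of_basis (b : HilbertBasis ι ℝ H) (y : HilbertPower d H)
    (hy : ∀ j : Fin d → ι, inner ℝ y (pureTensor fun l => b (j l)) = 0)
    (s : Finset (Fin d)) (x : Fin d → H) (hx : ∀ l ∉ s, ∃ i, x l = b i) :
    inner ℝ y (pureTensor x) = 0 := by
  induction s using Finset.induction_on generalizing x with
  | empty =>
    choose j hj using fun l => hx l (Finset.notMem_empty l)
    rw [show x = fun l => b (j l) from funext hj]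
    exact hy j
  | insert l s hl ih =>
    have h0 : slotFunctional y x l = 0 := by
      refine ContinuousLinearMap.ext_on (s := Set.range b) ?_ ?_
      · exact (Submodule.dense_iff_topologicalClosure_eq_top).2 b.dense_span
      · rintro _ ⟨i, rfl⟩
        rw [slotFunctional_apply, zero_apply]
        refine ih _ fun k hk => ?_
        by_cases hkl : k = l
        · subst hkl
          exact ⟨i, Function.update_self ..⟩
        · rw [Function.update_of_ne hkl]
          exact hx k (by simp [hkl, hk])
    have := slotFunctional_apply y x l (x l)
    rwa [h0, Function.update_eq_self, zero_apply, eq_comm] at this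

theorem orthonormal_pureTensor (b : HilbertBasis ι ℝ H) :
    Orthonormal ℝ fun j : Fin d → ι => pureTensor fun l => b (j l) := by
  constructor
  · intro j
    rw [norm_pureTensor]
    exact Finset.prod_eq_one fun l _ => b.orthonormal.1 _
  · intro j k hjk
    obtain ⟨l, hl⟩ := Function.ne_iff.1 hjk
    simp only [inner_pureTensor]
    exact Finset.prod_eq_zero (Finset.mem_univ l) (b.orthonormal.2 hl)

/-- The tensor products of the elements of a Hilbert basis. -/
def tensorBasis (b : HilbertBasis ι ℝ H) (d : ℕ) :
    HilbertBasis (Fin d → ι) ℝ (HilbertPower d H) :=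
  HilbertBasis.mkOfOrthogonalEqBot (orthonormal_pureTensor b) (by
    rw [eq_bot_iff]
    intro y hy
    have hy' (j : Fin d → ι) : inner ℝ y (pureTensor fun l => b (j l)) = 0 :=
      (Submodule.mem_orthogonal' _ _).1 hy _ (Submodule.subset_span ⟨j, rfl⟩)
    have h0 : innerSL ℝ y = 0 := ext_of_pureTensor fun x => by
      rw [innerSL_apply_apply, zero_apply]
      exact inner_pureTensor_eq_zero_of_basis b y hy' Finset.univ x (by simp)
    have : inner ℝ y y = 0 := by
      rw [← innerSL_apply_apply (𝕜 := ℝ), h0, zero_apply]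
    exact inner_self_eq_zero.1 this)

theorem tensorBasis_apply (b : HilbertBasis ι ℝ H) (j : Fin d → ι) :
    tensorBasis b d j = pureTensor fun l => b (j l) := by
  rw [tensorBasis, HilbertBasis.coe_mkOfOrthogonalEqBot]

theorem IsSingularSystem.tensorOp {S : H →L[ℝ] G} (h : IsSingularSystem S b mu) (d : ℕ) :
    IsSingularSystem (tensorOp d S) (tensorBasis b d) fun j => ∏ l, mu (j l) := by
  intro j k
  simp only [tensorBasis_apply, tensorOp_pureTensor, inner_pureTensor, h (j _) (k _),
    Finset.prod_mul_distrib]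

end TensorBasis

section SymmetricBasis

variable {d : ℕ} {H : Type*} [NormedAddCommGroup H] [InnerProductSpace ℝ H]
variable {G : Type*} [NormedAddCommGroup G] [InnerProductSpace ℝ G]
variable {ι : Type*} {I : Finset (Fin d)} {π ρ : Equiv.Perm (Fin d)}

theorem norm_permOp (f : HilbertPower d H) : ‖permOp π f‖ = ‖f‖ := by
  induction f using UniformSpace.Completion.induction_on with
  | hp => exact isClosed_eq (permOp π).continuous.norm continuous_norm
  | ih t =>
    rw [permOp, ContinuousLinearMap.completion_apply_coe, UniformSpace.Completion.norm_coe,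
      UniformSpace.Completion.norm_coe]
    exact AlgPower.norm_perm π t

theorem inner_permOp_permOp (f g : HilbertPower d H) :
    inner ℝ (permOp π f) (permOp π g) = inner ℝ f g :=
  LinearIsometry.inner_map_map
    (⟨(permOp π : HilbertPower d H →L[ℝ] HilbertPower d H).toLinearMap, norm_permOp⟩ :
      HilbertPower d H →ₗᵢ[ℝ] HilbertPower d H) f g

theorem mem_permsOn : π ∈ permsOn I ↔ ∀ l, l ∉ I → π l = l := by
  simp [permsOn]

theorem one_mem_permsOn (I : Finset (Fin d)) : 1 ∈ permsOn I := by simp [mem_permsOn]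

theorem mul_mem_permsOn (hπ : π ∈ permsOn I) (hρ : ρ ∈ permsOn I) : π * ρ ∈ permsOn I :=
  mem_permsOn.2 fun l hl => by
    rw [Equiv.Perm.mul_apply, mem_permsOn.1 hρ l hl, mem_permsOn.1 hπ l hl]

theorem inv_mem_permsOn (hπ : π ∈ permsOn I) : π⁻¹ ∈ permsOn I :=
  mem_permsOn.2 fun l hl => Equiv.Perm.inv_eq_iff_eq.2 (mem_permsOn.1 hπ l hl).symm

theorem card_permsOn_pos (I : Finset (Fin d)) : 0 < ((permsOn I).card : ℝ) := by
  exact_mod_cast Finset.card_pos.2 ⟨1, one_mem_permsOn I⟩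

/-- Two tuples are equivalent if a permutation of the coordinates in `I` carries one to the
other. -/
def permSetoid (I : Finset (Fin d)) (ι : Type*) : Setoid (Fin d → ι) where
  r j k := ∃ π ∈ permsOn I, j ∘ π = k
  iseqv :=
    { refl := fun _ => ⟨1, one_mem_permsOn I, rfl⟩
      symm := by
        rintro j _ ⟨π, hπ, rfl⟩
        exact ⟨π⁻¹, inv_mem_permsOn hπ, funext fun l => by simp⟩
      trans := by
        rintro j _ _ ⟨π, hπ, rfl⟩ ⟨ρ, hρ, rfl⟩
        exact ⟨π * ρ, mul_mem_permsOn hπ hρ, rfl⟩ }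

/-- The orbits of index tuples under the permutations of the coordinates in `I`; they index the
basis of the `I`-symmetric tensors. -/
abbrev SymIndex (I : Finset (Fin d)) (ι : Type*) : Type _ :=
  Quotient (permSetoid I ι)

/-- The product of the weights of the entries, as a function of the orbit of a tuple. -/
def symWeight (I : Finset (Fin d)) (ν : ι → ℝ) : SymIndex I ι → ℝ :=
  Quotient.lift (fun j => ∏ l, ν (j l)) (by
    rintro j _ ⟨π, -, rfl⟩
    exact (Equiv.prod_comp π fun l => ν (j l)).symm)

theorem symWeight_mk (I : Finset (Fin d)) (ν : ι → ℝ) (j : Fin d → ι) :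
    symWeight I ν (Quotient.mk _ j) = ∏ l, ν (j l) := rfl

theorem symWeight_out (ν : ι → ℝ) (o : SymIndex I ι) : symWeight I ν o = ∏ l, ν (o.out l) := by
  rw [← symWeight_mk I, Quotient.out_eq]

theorem symWeight_rpow {ν : ι → ℝ} (hν : ∀ i, 0 ≤ ν i) (τ : ℝ) (o : SymIndex I ι) :
    symWeight I (fun i => ν i ^ τ) o = symWeight I ν o ^ τ := by
  simp only [symWeight_out, Real.finsetProd_rpow _ _ fun _ _ => hν _]

theorem symWeight_le_one {ν : ι → ℝ} (h0 : ∀ i, 0 ≤ ν i) (h1 : ∀ i, ν i ≤ 1)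
    (o : SymIndex I ι) : symWeight I ν o ≤ 1 := by
  rw [symWeight_out]
  exact Finset.prod_le_one (fun _ _ => h0 _) fun _ _ => h1 _

theorem permOp_permOp (π ρ : Equiv.Perm (Fin d)) (f : HilbertPower d H) :
    permOp π (permOp ρ f) = permOp (ρ * π) f := by
  refine DFunLike.congr_fun (f := permOp π ∘L permOp ρ) (ext_of_pureTensor fun x => ?_) f
  simp [permOp_pureTensor]

theorem symmetrizer_apply (f : HilbertPower d H) :
    symmetrizer H I f = ((permsOn I).card : ℝ)⁻¹ • ∑ π ∈ permsOn I, permOp π f := by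
  simp only [symmetrizer, smul_apply, sum_apply]

theorem permOp_symmetrizer (hπ : π ∈ permsOn I) (f : HilbertPower d H) :
    permOp π (symmetrizer H I f) = symmetrizer H I f := by
  simp only [symmetrizer_apply, map_smul, map_sum, permOp_permOp]
  congr 1
  refine Finset.sum_nbij' (· * π) (· * π⁻¹) (fun ρ hρ => mul_mem_permsOn hρ hπ)
    (fun ρ hρ => mul_mem_permsOn hρ (inv_mem_permsOn hπ)) ?_ ?_ fun _ _ => rfl <;> simp

theorem permOp_coe (hπ : π ∈ permsOn I) (f : symSubspace H I) :
    permOp π (f : HilbertPower d H) = f := by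
  obtain ⟨_, g, rfl⟩ := f
  exact permOp_symmetrizer hπ g

theorem symmetrizer_coe (f : symSubspace H I) : symmetrizer H I (f : HilbertPower d H) = f := by
  rw [symmetrizer_apply, Finset.sum_congr rfl fun π hπ => permOp_coe hπ f, Finset.sum_const,
    ← Nat.cast_smul_eq_nsmul ℝ, inv_smul_smul₀ (card_permsOn_pos I).ne']

instance : CompleteSpace (symSubspace H I) :=
  have hidem : IsIdempotentElem (symmetrizer H I) :=
    ContinuousLinearMap.ext fun f => symmetrizer_coe (I := I) ⟨symmetrizer H I f, f, rfl⟩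
  (ContinuousLinearMap.IsIdempotentElem.isClosed_range hidem).completeSpace_coe

section SymTensor

variable (b : HilbertBasis ι ℝ H)

/-- The symmetrization of an element of the tensor product basis. -/
def symTensor (I : Finset (Fin d)) (j : Fin d → ι) : symSubspace H I :=
  ⟨symmetrizer H I (tensorBasis b d j), _, rfl⟩

theorem permOp_tensorBasis (π : Equiv.Perm (Fin d)) (j : Fin d → ι) :
    permOp π (tensorBasis b d j) = tensorBasis b d (j ∘ π) := by
  simp only [tensorBasis_apply, permOp_pureTensor, Function.comp_apply]

theorem coe_symTensor (j : Fin d → ι) :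
    (symTensor b I j : HilbertPower d H) =
      ((permsOn I).card : ℝ)⁻¹ • ∑ π ∈ permsOn I, tensorBasis b d (j ∘ π) := by
  simp only [symTensor, symmetrizer_apply, permOp_tensorBasis]

theorem inner_tensorBasis_comp_perm (hπ : π ∈ permsOn I) (j : Fin d → ι) (f : symSubspace H I) :
    inner ℝ (tensorBasis b d (j ∘ π)) (f : HilbertPower d H) =
      inner ℝ (tensorBasis b d j) (f : HilbertPower d H) := by
  rw [← permOp_tensorBasis, ← inner_permOp_permOp (π := π) (tensorBasis b d j), permOp_coe hπ]

theorem inner_symTensor (j : Fin d → ι) (f : symSubspace H I) :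
    inner ℝ (symTensor b I j) f = inner ℝ (tensorBasis b d j) (f : HilbertPower d H) := by
  rw [Submodule.coe_inner, coe_symTensor, inner_smul_left, sum_inner,
    Finset.sum_congr rfl fun π hπ => inner_tensorBasis_comp_perm b hπ j f, Finset.sum_const,
    nsmul_eq_mul, conj_trivial, inv_mul_cancel_left₀ (card_permsOn_pos I).ne']

theorem inner_symTensor_symTensor [DecidableEq ι] (j k : Fin d → ι) :
    inner ℝ (symTensor b I j) (symTensor b I k) =
      ((permsOn I).card : ℝ)⁻¹ *
        ((permsOn I).filter fun π : Equiv.Perm (Fin d) => j = k ∘ π).card := by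
  rw [inner_symTensor, coe_symTensor, inner_smul_right, inner_sum, Finset.card_filter]
  push_cast
  congr 1
  exact Finset.sum_congr rfl fun π _ =>
    orthonormal_iff_ite.1 (tensorBasis b d).orthonormal j (k ∘ π)

theorem inner_symTensor_eq_zero {j k : Fin d → ι} (h : ¬ permSetoid I ι k j) :
    inner ℝ (symTensor b I j) (symTensor b I k) = 0 := by
  classical
  rw [inner_symTensor_symTensor, Finset.filter_false_of_mem fun π hπ hjk => h ⟨π, hπ, hjk.symm⟩,
    Finset.card_empty, Nat.cast_zero, mul_zero]

theorem symTensor_ne_zero (I : Finset (Fin d)) (j : Fin d → ι) : symTensor b I j ≠ 0 := by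
  classical
  rw [← norm_ne_zero_iff, ← sq_eq_zero_iff.ne, ← real_inner_self_eq_norm_sq,
    inner_symTensor_symTensor]
  refine mul_ne_zero (inv_ne_zero (card_permsOn_pos I).ne') (Nat.cast_ne_zero.2 ?_)
  exact Finset.card_ne_zero.2 ⟨1, Finset.mem_filter.2 ⟨one_mem_permsOn I, rfl⟩⟩

theorem eq_zero_of_inner_symTensor_eq_zero {f : symSubspace H I}
    (hf : ∀ o : SymIndex I ι, inner ℝ (symTensor b I o.out) f = 0) : f = 0 := by
  have hzero (j : Fin d → ι) : inner ℝ (tensorBasis b d j) (f : HilbertPower d H) = 0 := by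
    obtain ⟨π, hπ, hj⟩ := Quotient.mk_out (s := permSetoid I ι) j
    rw [← hj, inner_tensorBasis_comp_perm b hπ, ← inner_symTensor, hf]
  have hsum := hasSum_inner_hilbertBasis_sq (tensorBasis b d) (f : HilbertPower d H)
  simp only [hzero, ne_eq, OfNat.ofNat_ne_zero, not_false_eq_true, zero_pow] at hsum
  exact norm_eq_zero.1 (sq_eq_zero_iff.1 (hsum.unique hasSum_zero))

end SymTensor

variable {S : H →L[ℝ] G} {b : HilbertBasis ι ℝ H} {mu : ι → ℝ}

theorem IsSingularSystem.inner_symProblem_symTensor (h : IsSingularSystem S b mu)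
    (j : Fin d → ι) (f : symSubspace H I) :
    inner ℝ (symProblem S I (symTensor b I j)) (symProblem S I f) =
      (∏ l, mu (j l)) * inner ℝ (symTensor b I j) f := by
  have hterm (π : Equiv.Perm (Fin d)) (hπ : π ∈ permsOn I) :
      inner ℝ (TensorProblem.tensorOp d S (tensorBasis b d (j ∘ π)))
        (TensorProblem.tensorOp d S f) = (∏ l, mu (j l)) * inner ℝ (symTensor b I j) f := by
    rw [(h.tensorOp d).inner_map_map, inner_tensorBasis_comp_perm b hπ, inner_symTensor]
    exact congrArg (· * _) (Equiv.prod_comp π fun l => mu (j l))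
  change inner ℝ (TensorProblem.tensorOp d S (symTensor b I j)) (TensorProblem.tensorOp d S f) = _
  rw [coe_symTensor, map_smul, map_sum, inner_smul_left, sum_inner, Finset.sum_congr rfl hterm,
    Finset.sum_const, nsmul_eq_mul, conj_trivial, inv_mul_cancel_left₀ (card_permsOn_pos I).ne']

theorem IsSingularSystem.exists_symProblem (h : IsSingularSystem S b mu) (I : Finset (Fin d)) :
    ∃ B : HilbertBasis (SymIndex I ι) ℝ (symSubspace H I),
      IsSingularSystem (symProblem S I) B (symWeight I mu) := by
  have horth : Pairwise fun o p : SymIndex I ι =>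
      inner ℝ (symTensor b I o.out) (symTensor b I p.out) = 0 := fun o p hop =>
    inner_symTensor_eq_zero b fun h => hop (Quotient.out_equiv_out.1 h).symm
  have hT (o : SymIndex I ι) := h.inner_symProblem_symTensor (I := I) o.out
  simp only [← symWeight_out] at hT
  exact exists_isSingularSystem_of_orthogonal
    (fun o => symTensor_ne_zero b I o.out) horth
    (fun _ hf => eq_zero_of_inner_symTensor_eq_zero b hf) hT

end SymmetricBasis

section OrbitCode

variable {d : ℕ} {ι : Type*} [DecidableEq ι]

theorem exists_perm_of_card_fiber_eq (I : Finset (Fin d)) {j k : Fin d → ι}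
    (hout : ∀ l, l ∉ I → j l = k l) (hin : ∀ i, {l ∈ I | j l = i}.card = {l ∈ I | k l = i}.card) :
    ∃ π ∈ permsOn I, j ∘ π = k := by
  have hfiber (u : Fin d → ι) (i : ι) :
      Fintype.card {l : {l // l ∈ I} // u l = i} = {l ∈ I | u l = i}.card := by
    rw [← Fintype.card_coe]
    exact Fintype.card_congr ((Equiv.subtypeSubtypeEquivSubtypeInter (· ∈ I) (u · = i)).trans
      (Equiv.subtypeEquivRight fun l => by simp))
  let e (i : ι) : {l : {l // l ∈ I} // k l = i} ≃ {l : {l // l ∈ I} // j l = i} :=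
    Fintype.equivOfCardEq (by rw [hfiber, hfiber, hin i])
  let φ : Equiv.Perm {l // l ∈ I} := Equiv.ofFiberEquiv e
  have hφ (l : {l // l ∈ I}) : j (φ l) = k l := Equiv.ofFiberEquiv_map e l
  refine ⟨Equiv.Perm.ofSubtype φ, mem_permsOn.2 fun l hl =>
    Equiv.Perm.ofSubtype_apply_of_not_mem φ hl, funext fun l => ?_⟩
  by_cases hl : l ∈ I
  · rw [Function.comp_apply, Equiv.Perm.ofSubtype_apply_of_mem φ hl]
    exact hφ ⟨l, hl⟩
  · rw [Function.comp_apply, Equiv.Perm.ofSubtype_apply_of_not_mem φ hl, hout l hl]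

theorem card_fiber_eq_of_ne {α : Type*} (I : Finset α) {j k : α → ι} (i₀ : ι)
    (h : ∀ i ≠ i₀, {l ∈ I | j l = i}.card = {l ∈ I | k l = i}.card) (i : ι) :
    {l ∈ I | j l = i}.card = {l ∈ I | k l = i}.card := by
  rcases eq_or_ne i i₀ with rfl | hi
  · let T : Finset ι := insert i (I.image j ∪ I.image k)
    have hj : I.card = ∑ x ∈ T, {l ∈ I | j l = x}.card :=
      Finset.card_eq_sum_card_fiberwise fun l hl =>
        Finset.mem_insert_of_mem (Finset.mem_union_left _ (Finset.mem_image_of_mem j hl))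
    have hk : I.card = ∑ x ∈ T, {l ∈ I | k l = x}.card :=
      Finset.card_eq_sum_card_fiberwise fun l hl =>
        Finset.mem_insert_of_mem (Finset.mem_union_right _ (Finset.mem_image_of_mem k hl))
    have herase : ∑ x ∈ T.erase i, {l ∈ I | j l = x}.card =
        ∑ x ∈ T.erase i, {l ∈ I | k l = x}.card :=
      Finset.sum_congr rfl fun x hx => h x (Finset.ne_of_mem_erase hx)
    have hiT : i ∈ T := Finset.mem_insert_self _ _
    rw [← Finset.add_sum_erase _ _ hiT] at hj hk
    lia
  · exact h i hi

/-- A code for the orbit of a tuple: the number of occurrences of each `i ∈ s` in the coordinates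
from `I`, and the entries in the other coordinates. -/
def orbitCode (I : Finset (Fin d)) (s : Finset ι) (j : Fin d → ι) :
    ({i // i ∈ s} → ℕ) × ({l // l ∉ I} → ι) :=
  (fun i => {l ∈ I | j l = i}.card, fun l => j l)

/-- The product of the weights of the entries that a code describes. -/
def codeWeight (I : Finset (Fin d)) (s : Finset ι) (ν : ι → ℝ)
    (a : ({i // i ∈ s} → ℕ) × ({l // l ∉ I} → ι)) : ℝ :=
  (∏ i : {i // i ∈ s}, ν i ^ a.1 i) * ∏ l, ν (a.2 l)

-- The number of occurrences of `i₀` on `I` is determined by the other ones.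
theorem permSetoid_of_orbitCode_eq (I : Finset (Fin d)) {s : Finset ι} {i₀ : ι} {j k : Fin d → ι}
    (hj : ∀ l, j l ∈ s) (hk : ∀ l, k l ∈ s)
    (h : orbitCode I (s.erase i₀) j = orbitCode I (s.erase i₀) k) : permSetoid I ι j k := by
  refine exists_perm_of_card_fiber_eq I (fun l hl => congrFun (congrArg Prod.snd h) ⟨l, hl⟩)
    (card_fiber_eq_of_ne I i₀ fun i hi => ?_)
  by_cases his : i ∈ s
  · exact congrFun (congrArg Prod.fst h) ⟨i, Finset.mem_erase.2 ⟨hi, his⟩⟩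
  · rw [Finset.filter_false_of_mem fun l _ (h : j l = i) => his (h ▸ hj l),
      Finset.filter_false_of_mem fun l _ (h : k l = i) => his (h ▸ hk l)]

variable {ν : ι → ℝ}

theorem prod_le_codeWeight_orbitCode (I : Finset (Fin d)) {s : Finset ι} (i₀ : ι)
    (h0 : ∀ i, 0 ≤ ν i) (h1 : ν i₀ ≤ 1) {j : Fin d → ι} (hj : ∀ l, j l ∈ s) :
    ∏ l, ν (j l) ≤ codeWeight I (s.erase i₀) ν (orbitCode I (s.erase i₀) j) := by
  have hfiber : ∏ l ∈ I, ν (j l) = ∏ i ∈ s, ν i ^ {l ∈ I | j l = i}.card := by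
    rw [← Finset.prod_fiberwise_of_maps_to (t := s) (g := j) fun l _ => hj l]
    refine Finset.prod_congr rfl fun i _ => ?_
    rw [Finset.prod_congr rfl fun l hl => by rw [(Finset.mem_filter.1 hl).2], Finset.prod_const]
  have herase : ∏ i ∈ s, ν i ^ {l ∈ I | j l = i}.card ≤
      ∏ i ∈ s.erase i₀, ν i ^ {l ∈ I | j l = i}.card := by
    by_cases hi : i₀ ∈ s
    · rw [← Finset.mul_prod_erase _ _ hi]
      exact mul_le_of_le_one_left (Finset.prod_nonneg fun i _ => pow_nonneg (h0 i) _)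
        (pow_le_one₀ (h0 _) h1)
    · rw [Finset.erase_eq_of_notMem hi]
  have hcompl : ∏ l : {l // l ∉ I}, ν (j l) = ∏ l ∈ Iᶜ, ν (j l) :=
    (Finset.prod_subtype _ (by simp) fun l => ν (j l)).symm
  simp only [codeWeight, orbitCode]
  rw [hcompl, Finset.prod_coe_sort (s.erase i₀) fun i => ν i ^ {l ∈ I | j l = i}.card,
    ← Finset.prod_mul_prod_compl I]
  exact mul_le_mul_of_nonneg_right (hfiber.trans_le herase) (Finset.prod_nonneg fun l _ => h0 _)

theorem sum_codeWeight (I : Finset (Fin d)) (s t : Finset ι) (ν : ι → ℝ) (n : ℕ) :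
    ∑ a ∈ (Fintype.piFinset fun _ : {i // i ∈ s} => Finset.range n) ×ˢ
      (Fintype.piFinset fun _ : {l // l ∉ I} => t), codeWeight I s ν a =
    (∏ i ∈ s, ∑ m ∈ Finset.range n, ν i ^ m) * (∑ i ∈ t, ν i) ^ (d - I.card) := by
  simp only [Finset.sum_product, codeWeight, ← Finset.mul_sum, ← Finset.sum_mul]
  rw [← Finset.prod_univ_sum, ← Finset.prod_univ_sum, Finset.prod_const,
    Finset.prod_coe_sort s fun i => ∑ m ∈ Finset.range n, ν i ^ m]
  congr 2
  rw [Finset.card_univ, Fintype.card_subtype_compl]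
  simp

theorem sum_symWeight_le_prod_geom_sum_mul_pow (I : Finset (Fin d)) (A : Finset (SymIndex I ι))
    (i₀ : ι) (h0 : ∀ i, 0 ≤ ν i) (h1 : ν i₀ ≤ 1) :
    ∃ s : Finset ι, ∑ o ∈ A, symWeight I ν o ≤
      (∏ i ∈ s.erase i₀, ∑ m ∈ Finset.range (d + 1), ν i ^ m) * (∑ i ∈ s, ν i) ^ (d - I.card) := by
  let s : Finset ι := A.biUnion fun o => Finset.univ.image o.out
  have hs (o) (ho : o ∈ A) (l : Fin d) : o.out l ∈ s :=
    Finset.mem_biUnion.2 ⟨o, ho, Finset.mem_image_of_mem _ (Finset.mem_univ l)⟩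
  let code (o : SymIndex I ι) := orbitCode I (s.erase i₀) o.out
  have hinj : Set.InjOn code A := fun o ho p hp h =>
    Quotient.out_equiv_out.1 (permSetoid_of_orbitCode_eq I (hs o ho) (hs p hp) h)
  refine ⟨s, ?_⟩
  rw [← sum_codeWeight]
  calc ∑ o ∈ A, symWeight I ν o ≤ ∑ o ∈ A, codeWeight I (s.erase i₀) ν (code o) :=
        Finset.sum_le_sum fun o ho =>
          (symWeight_out ν o).trans_le (prod_le_codeWeight_orbitCode I i₀ h0 h1 (hs o ho))
    _ = ∑ a ∈ A.image code, codeWeight I (s.erase i₀) ν a := (Finset.sum_image hinj).symm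
    _ ≤ _ := Finset.sum_le_sum_of_subset_of_nonneg (Finset.image_subset_iff.2 fun o ho => ?_)
        fun a _ _ => mul_nonneg (Finset.prod_nonneg fun i _ => pow_nonneg (h0 _) _)
          (Finset.prod_nonneg fun l _ => h0 _)
  refine Finset.mem_product.2 ⟨Fintype.mem_piFinset.2 fun i => ?_,
    Fintype.mem_piFinset.2 fun l => hs o ho l⟩
  exact Finset.mem_range_succ_iff.2 ((Finset.card_le_univ _).trans_eq (Fintype.card_fin d))

end OrbitCode

section PowerSums

variable {d : ℕ} {ι : Type*} {I : Finset (Fin d)} {ν : ι → ℝ}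

theorem geom_sum_le_exp {x : ℝ} (h0 : 0 ≤ x) (h : x ≤ 1 / 2) (n : ℕ) :
    ∑ m ∈ Finset.range n, x ^ m ≤ Real.exp (2 * x) := by
  have hgeom : ∑ m ∈ Finset.range n, x ^ m ≤ (1 - x)⁻¹ := by
    rw [← tsum_geometric_of_lt_one h0 (by linarith)]
    exact (summable_geometric_of_lt_one h0 (by linarith)).sum_le_tsum _ fun m _ => pow_nonneg h0 m
  have hinv : (1 - x)⁻¹ ≤ 1 + 2 * x :=
    (inv_le_iff_one_le_mul₀ (by linarith)).2 (by nlinarith)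
  linarith [Real.add_one_le_exp (2 * x)]

theorem prod_geom_sum_le (s K : Finset ι) (n : ℕ) (h0 : ∀ i, 0 ≤ ν i)
    (h1 : ∀ i, ν i ≤ 1) (hK : ∀ i ∈ s, i ∉ K → ν i ≤ 1 / 2) :
    ∏ i ∈ s, ∑ m ∈ Finset.range (n + 1), ν i ^ m ≤
      (n + 1) ^ K.card * Real.exp (2 * ∑ i ∈ s, ν i) := by
  classical
  have hfactor (i) (hi : i ∈ s) : ∑ m ∈ Finset.range (n + 1), ν i ^ m ≤
      (if i ∈ K then (n + 1 : ℝ) else 1) * Real.exp (2 * ν i) := by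
    split_ifs with hiK
    · have hle : ∑ m ∈ Finset.range (n + 1), ν i ^ m ≤ (n + 1 : ℝ) := by
        simpa using Finset.sum_le_card_nsmul (Finset.range (n + 1)) (fun m => ν i ^ m) 1
          fun m _ => pow_le_one₀ (h0 i) (h1 i)
      exact hle.trans (le_mul_of_one_le_right (by positivity)
        (Real.one_le_exp (mul_nonneg two_pos.le (h0 i))))
    · rw [one_mul]
      exact geom_sum_le_exp (h0 i) (hK i hi hiK) _
  calc ∏ i ∈ s, ∑ m ∈ Finset.range (n + 1), ν i ^ m
      ≤ ∏ i ∈ s, (if i ∈ K then (n + 1 : ℝ) else 1) * Real.exp (2 * ν i) :=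
        Finset.prod_le_prod (fun i _ => Finset.sum_nonneg fun m _ => pow_nonneg (h0 i) m) hfactor
    _ = (n + 1) ^ (s ∩ K).card * Real.exp (2 * ∑ i ∈ s, ν i) := by
        rw [Finset.prod_mul_distrib, Finset.prod_ite_mem, Finset.prod_const, Finset.mul_sum,
          Real.exp_sum]
    _ ≤ (n + 1) ^ K.card * Real.exp (2 * ∑ i ∈ s, ν i) := by
        gcongr
        · linarith [n.cast_nonneg (α := ℝ)]
        · exact Finset.inter_subset_right

theorem sum_symWeight_le (A : Finset (SymIndex I ι)) {σ : ℝ} {i₀ : ι} {K : Finset ι}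
    (h0 : ∀ i, 0 ≤ ν i) (h1 : ∀ i, ν i ≤ 1) (hσ : ∀ s : Finset ι, ∑ i ∈ s, ν i ≤ σ)
    (hK : ∀ i ≠ i₀, i ∉ K → ν i ≤ 1 / 2) :
    ∑ o ∈ A, symWeight I ν o ≤
      (d + 1) ^ K.card * Real.exp (2 * σ) * σ ^ (d - I.card) := by
  classical
  obtain ⟨s, hs⟩ := sum_symWeight_le_prod_geom_sum_mul_pow I A i₀ h0 (h1 i₀)
  have hprod := prod_geom_sum_le (s.erase i₀) K d h0 h1 fun i hi => hK i (Finset.ne_of_mem_erase hi)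
  have hnonneg : 0 ≤ ∑ i ∈ s, ν i := Finset.sum_nonneg fun i _ => h0 i
  refine hs.trans (mul_le_mul (hprod.trans ?_) (pow_le_pow_left₀ hnonneg (hσ s) _)
    (pow_nonneg hnonneg _) (by positivity))
  gcongr
  exact hσ _

theorem sum_prod_le_of_sum_symWeight_le {C : ℝ}
    (hC : ∀ A : Finset (SymIndex I ι), ∑ o ∈ A, symWeight I ν o ≤ C) {α : Type*} {s : Finset α}
    {g : α → Fin d → ι} (hg : ∀ a ∈ s, ∀ a' ∈ s, permSetoid I ι (g a) (g a') → a = a') :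
    ∑ a ∈ s, ∏ l, ν (g a l) ≤ C := by
  classical
  have hinj : Set.InjOn (fun a => (Quotient.mk _ (g a) : SymIndex I ι)) s := fun a ha a' ha' h =>
    hg a ha a' ha' (Quotient.exact h)
  have hsum := hC (s.image fun a => Quotient.mk _ (g a))
  rwa [Finset.sum_image hinj] at hsum

theorem sum_le_of_sum_symWeight_le {I : Finset (Fin 1)} {C : ℝ}
    (hC : ∀ A : Finset (SymIndex I ι), ∑ o ∈ A, symWeight I ν o ≤ C) (s : Finset ι) :
    ∑ i ∈ s, ν i ≤ C := by
  have h := sum_prod_le_of_sum_symWeight_le hC (s := s) (g := fun i _ => i) (by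
    rintro i _ i' _ ⟨π, -, h⟩
    exact congrFun h 0)
  simpa only [Finset.univ_unique, Finset.prod_const, Finset.card_singleton, pow_one] using h

section TwoValues

variable {i₀ i₁ : ι}

/-- The tuple with the entry `i₁` on `t` and the entry `i₀` elsewhere. -/
def indicatorTuple (i₀ i₁ : ι) (t : Finset (Fin d)) : Fin d → ι :=
  fun l => if l ∈ t then i₁ else i₀

theorem indicatorTuple_eq_iff (hi : i₀ ≠ i₁) (t : Finset (Fin d)) (l : Fin d) :
    indicatorTuple i₀ i₁ t l = i₁ ↔ l ∈ t := by
  simp [indicatorTuple, hi]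

theorem exists_perm_of_permSetoid_indicatorTuple (hi : i₀ ≠ i₁) {t t' : Finset (Fin d)}
    (h : permSetoid I ι (indicatorTuple i₀ i₁ t) (indicatorTuple i₀ i₁ t')) :
    ∃ π ∈ permsOn I, ∀ l, π l ∈ t ↔ l ∈ t' := by
  obtain ⟨π, hπ, h⟩ := h
  refine ⟨π, hπ, fun l => ?_⟩
  rw [← indicatorTuple_eq_iff hi t', ← h, Function.comp_apply, indicatorTuple_eq_iff hi]

theorem prod_indicatorTuple (h : ν i₀ = 1) (t : Finset (Fin d)) :
    ∏ l, ν (indicatorTuple i₀ i₁ t l) = ν i₁ ^ t.card := by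
  simp only [indicatorTuple, apply_ite ν, h, Finset.prod_ite_mem, Finset.univ_inter,
    Finset.prod_const]

variable {C : ℝ} (hC : ∀ A : Finset (SymIndex I ι), ∑ o ∈ A, symWeight I ν o ≤ C)
include hC

theorem one_add_pow_le_of_sum_symWeight_le (hi : i₀ ≠ i₁) (h : ν i₀ = 1) :
    (1 + ν i₁) ^ (d - I.card) ≤ C := by
  have hsum := sum_prod_le_of_sum_symWeight_le hC (s := Iᶜ.powerset) (g := indicatorTuple i₀ i₁) (by
    intro t ht t' ht' htt'
    obtain ⟨π, hπ, hmem⟩ := exists_perm_of_permSetoid_indicatorTuple hi htt'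
    ext l
    by_cases hl : l ∈ I
    · have hnot (u) (hu : u ∈ Iᶜ.powerset) : l ∉ u := fun hlu =>
        Finset.mem_compl.1 (Finset.mem_powerset.1 hu hlu) hl
      exact iff_of_false (hnot t ht) (hnot t' ht')
    · rw [← hmem, mem_permsOn.1 hπ l hl])
  simp only [prod_indicatorTuple h] at hsum
  have hbinom := Finset.sum_pow_mul_eq_add_pow (ν i₁) 1 Iᶜ
  simp only [one_pow, mul_one, Finset.card_compl, Fintype.card_fin] at hbinom
  rwa [add_comm, ← hbinom]

theorem card_add_one_le_of_sum_symWeight_le (hi : i₀ ≠ i₁) (h : ν i₀ = 1) (h' : ν i₁ = 1) :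
    (I.card : ℝ) + 1 ≤ C := by
  have ht (m : Fin (I.card + 1)) : ∃ t ⊆ I, t.card = m :=
    Finset.exists_subset_card_eq (Nat.lt_succ_iff.1 m.2)
  choose t _ htcard using ht
  have hsum := sum_prod_le_of_sum_symWeight_le hC (s := Finset.univ)
    (g := fun m => indicatorTuple i₀ i₁ (t m)) (by
      intro m _ m' _ hmm'
      obtain ⟨π, -, hmem⟩ := exists_perm_of_permSetoid_indicatorTuple hi hmm'
      have hmap : (t m').map π.toEmbedding = t m := by
        ext l
        rw [Finset.mem_map_equiv, ← hmem, π.apply_symm_apply]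
      rw [← Fin.val_inj, ← htcard, ← htcard, ← hmap, Finset.card_map])
  simpa [prod_indicatorTuple h, h'] using hsum

end TwoValues

end PowerSums

section Growth

variable {e : ℕ → ℕ} {x : ℝ}

theorem isBigO_one_iff_exists_pow_le (hx : 1 < x) :
    (fun d => (e d : ℝ)) =O[Filter.atTop] (fun _ => (1 : ℝ)) ↔
      ∃ C : ℝ, 0 < C ∧ ∀ d, 1 ≤ d → x ^ e d ≤ C := by
  rw [Asymptotics.isBigO_one_nat_atTop_iff]
  constructor
  · rintro ⟨c, hc⟩
    refine ⟨x ^ ⌈c⌉₊, by positivity, fun d _ => pow_le_pow_right₀ hx.le ?_⟩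
    exact Nat.cast_le.1 (((Real.norm_natCast _).symm.trans_le (hc d)).trans (Nat.le_ceil c))
  · rintro ⟨C, -, hC⟩
    refine (Asymptotics.isBigO_one_nat_atTop_iff (f := fun d => (e d : ℝ))).1
      (Asymptotics.IsBigO.of_bound (Real.log C / Real.log x) ?_)
    filter_upwards [Filter.eventually_ge_atTop 1] with d hd
    rw [norm_one, mul_one, Real.norm_natCast, le_div_iff₀ (Real.log_pos hx), ← Real.log_pow]
    exact Real.log_le_log (by positivity) (hC d hd)

theorem isBigO_log_iff_exists_pow_le (hx : 1 < x) :
    (fun d => (e d : ℝ)) =O[Filter.atTop] (fun d : ℕ => Real.log d) ↔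
      ∃ C q : ℝ, 0 < C ∧ 0 ≤ q ∧ ∀ d : ℕ, 1 ≤ d → x ^ e d ≤ C * (d : ℝ) ^ q := by
  have hlogx : 0 < Real.log x := Real.log_pos hx
  constructor
  · intro h
    obtain ⟨c, hc0, hc⟩ := Asymptotics.bound_of_isBigO_nat_atTop h
    refine ⟨x ^ e 1, c * Real.log x, by positivity, by positivity, fun d hd => ?_⟩
    obtain rfl | hd1 := hd.eq_or_lt
    · simp
    have hlog : 0 < Real.log d := Real.log_pos (by exact_mod_cast hd1)
    have hed := hc hlog.ne'
    rw [Real.norm_natCast, Real.norm_of_nonneg hlog.le] at hed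
    calc x ^ e d = Real.exp (Real.log x * e d) := by
          rw [← Real.rpow_def_of_pos (by positivity), Real.rpow_natCast]
      _ ≤ Real.exp (Real.log d * (c * Real.log x)) :=
          Real.exp_le_exp.2 (by linarith [mul_le_mul_of_nonneg_left hed hlogx.le])
      _ = (d : ℝ) ^ (c * Real.log x) := (Real.rpow_def_of_pos (by positivity) _).symm
      _ ≤ x ^ e 1 * (d : ℝ) ^ (c * Real.log x) :=
          le_mul_of_one_le_left (by positivity) (one_le_pow₀ hx.le)
  · rintro ⟨C, q, hC0, -, hC⟩
    refine Asymptotics.IsBigO.of_bound ((|Real.log C| + q) / Real.log x) ?_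
    have hlog : ∀ᶠ d : ℕ in Filter.atTop, 1 ≤ Real.log d :=
      (Real.tendsto_log_atTop.comp tendsto_natCast_atTop_atTop).eventually_ge_atTop 1
    filter_upwards [hlog, Filter.eventually_ge_atTop 1] with d hlogd hd
    have hd0 : (0 : ℝ) < d := by exact_mod_cast hd
    rw [Real.norm_natCast, Real.norm_of_nonneg (by linarith), div_mul_eq_mul_div,
      le_div_iff₀ hlogx, ← Real.log_pow]
    calc Real.log (x ^ e d) ≤ Real.log (C * (d : ℝ) ^ q) :=
          Real.log_le_log (by positivity) (hC d hd)
      _ = Real.log C + q * Real.log d := by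
          rw [Real.log_mul hC0.ne' (by positivity), Real.log_rpow hd0]
      _ ≤ |Real.log C| * Real.log d + q * Real.log d := by
          gcongr
          exact (le_abs_self _).trans (le_mul_of_one_le_right (abs_nonneg _) hlogd)
      _ = (|Real.log C| + q) * Real.log d := (add_mul _ _ _).symm

theorem natCast_sub_card {d : ℕ} (I : Finset (Fin d)) :
    ((d - I.card : ℕ) : ℝ) = (d : ℝ) - (I.card : ℝ) :=
  Nat.cast_sub (by simpa using Finset.card_le_univ I)

end Growth

section Sufficiency

variable {ι : Type*} {mu : ι → ℝ} {τ c : ℝ} (h0 : ∀ i, 0 ≤ mu i)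
include h0

theorem exists_forall_sum_rpow_le {δ : ℝ} (hτ : 0 < τ) (hsum : Summable fun i => mu i ^ τ)
    (hc0 : 0 ≤ c) (hc1 : c < 1) (hδ : 0 < δ) :
    ∃ τ' : ℝ, 0 < τ' ∧ ∀ s : Finset ι, (∀ i ∈ s, mu i ≤ c) → ∑ i ∈ s, mu i ^ τ' ≤ δ := by
  have hM : 0 ≤ ∑' i, mu i ^ τ := tsum_nonneg fun i => Real.rpow_nonneg (h0 i) τ
  obtain ⟨n, hn⟩ := exists_pow_lt_of_lt_one (div_pos hδ (by linarith : 0 < ∑' i, mu i ^ τ + 1)) hc1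
  rw [lt_div_iff₀ (by linarith)] at hn
  refine ⟨τ + n, by positivity, fun s hs => ?_⟩
  calc ∑ i ∈ s, mu i ^ (τ + n) ≤ ∑ i ∈ s, mu i ^ τ * c ^ n := by
        refine Finset.sum_le_sum fun i hi => ?_
        rw [Real.rpow_add_of_nonneg (h0 i) hτ.le n.cast_nonneg, Real.rpow_natCast]
        exact mul_le_mul_of_nonneg_left (pow_le_pow_left₀ (h0 i) (hs i hi) n)
          (Real.rpow_nonneg (h0 i) τ)
    _ ≤ (∑' i, mu i ^ τ) * c ^ n := by
        rw [← Finset.sum_mul]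
        exact mul_le_mul_of_nonneg_right
          (hsum.sum_le_tsum s fun i _ => Real.rpow_nonneg (h0 i) τ) (pow_nonneg hc0 n)
    _ ≤ δ := by linarith [pow_nonneg hc0 n]

variable (I : (d : ℕ) → Finset (Fin d))

theorem exists_sum_symWeight_rpow_le_of_le [Nonempty ι] (hτ : 0 < τ)
    (hsum : Summable fun i => mu i ^ τ) (hc1 : c < 1) (hc : ∀ i, mu i ≤ c) :
    ∃ τ' C : ℝ, 0 < τ' ∧ 0 < C ∧ ∀ d (A : Finset (SymIndex (I d) ι)),
      ∑ o ∈ A, symWeight (I d) (fun i => mu i ^ τ') o ≤ C := by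
  obtain ⟨i₀⟩ := ‹Nonempty ι›
  obtain ⟨τ', hτ', hhalf⟩ := exists_forall_sum_rpow_le h0 hτ hsum ((h0 i₀).trans (hc i₀)) hc1
    one_half_pos
  refine ⟨τ', Real.exp 1, hτ', Real.exp_pos 1, fun d A => ?_⟩
  have hbound := sum_symWeight_le (i₀ := i₀) (K := ∅) A (fun i => Real.rpow_nonneg (h0 i) τ')
    (fun i => Real.rpow_le_one (h0 i) ((hc i).trans hc1.le) hτ'.le)
    (fun s => hhalf s fun i _ => hc i)
    (fun i _ _ => by simpa using hhalf {i} fun i _ => hc i)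
  norm_num at hbound
  exact hbound.trans (mul_le_of_le_one_right (Real.exp_pos 1).le
    (pow_le_one₀ (by norm_num) (by norm_num)))

variable {I} (h1 : ∀ i, mu i ≤ 1) {i₀ : ι}
include h1

theorem exists_sum_symWeight_rpow_le_of_isBigO_one (hτ : 0 < τ)
    (hsum : Summable fun i => mu i ^ τ) (hc0 : 0 ≤ c) (hc1 : c < 1) (hc : ∀ i ≠ i₀, mu i ≤ c)
    (hI : (fun d => ((d - (I d).card : ℕ) : ℝ)) =O[Filter.atTop] (fun _ => (1 : ℝ))) :
    ∃ τ' C : ℝ, 0 < τ' ∧ 0 < C ∧ ∀ d, 1 ≤ d → ∀ A : Finset (SymIndex (I d) ι),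
      ∑ o ∈ A, symWeight (I d) (fun i => mu i ^ τ') o ≤ C := by
  classical
  obtain ⟨τ', hτ', hhalf⟩ := exists_forall_sum_rpow_le h0 hτ hsum hc0 hc1 one_half_pos
  have hle_one (i) : mu i ^ τ' ≤ 1 := Real.rpow_le_one (h0 i) (h1 i) hτ'.le
  have hnonneg (i) : 0 ≤ mu i ^ τ' := Real.rpow_nonneg (h0 i) τ'
  have htotal (s : Finset ι) : ∑ i ∈ s, mu i ^ τ' ≤ 3 / 2 :=
    calc ∑ i ∈ s, mu i ^ τ' ≤ ∑ i ∈ insert i₀ (s.erase i₀), mu i ^ τ' :=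
          Finset.sum_le_sum_of_subset_of_nonneg (Finset.subset_insert_iff.2 subset_rfl)
            fun i _ _ => hnonneg i
      _ = mu i₀ ^ τ' + ∑ i ∈ s.erase i₀, mu i ^ τ' :=
          Finset.sum_insert (Finset.notMem_erase i₀ s)
      _ ≤ 1 + 1 / 2 := add_le_add (hle_one i₀)
          (hhalf _ fun i hi => hc i (Finset.ne_of_mem_erase hi))
      _ = 3 / 2 := by norm_num
  obtain ⟨C, hC0, hC⟩ := (isBigO_one_iff_exists_pow_le (x := 3 / 2) (by norm_num)).1 hI
  refine ⟨τ', Real.exp 3 * C, hτ', by positivity, fun d hd A => ?_⟩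
  have hbound := sum_symWeight_le (K := ∅) A hnonneg hle_one htotal
    (fun i hi _ => by simpa using hhalf {i} fun j hj => hc j (Finset.mem_singleton.1 hj ▸ hi))
  norm_num at hbound
  exact hbound.trans (mul_le_mul_of_nonneg_left (hC d hd) (Real.exp_pos 3).le)

theorem exists_sum_symWeight_rpow_le_of_isBigO_log [Nonempty ι] (hτ : 0 < τ)
    (hsum : Summable fun i => mu i ^ τ)
    (hI : (fun d => ((d - (I d).card : ℕ) : ℝ)) =O[Filter.atTop] (fun d : ℕ => Real.log d)) :
    ∃ C q : ℝ, 0 < C ∧ 0 ≤ q ∧ ∀ d, 1 ≤ d → ∀ A : Finset (SymIndex (I d) ι),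
      ∑ o ∈ A, symWeight (I d) (fun i => mu i ^ τ) o ≤ C * d ^ q := by
  obtain ⟨i₀⟩ := ‹Nonempty ι›
  have hnonneg (i) : 0 ≤ mu i ^ τ := Real.rpow_nonneg (h0 i) τ
  have hfin : {i | ¬ mu i ^ τ ≤ 1 / 2}.Finite := Filter.eventually_cofinite.1
    (hsum.tendsto_cofinite_zero.eventually_le_const one_half_pos)
  let k := hfin.toFinset.card
  let σ := ∑' i, mu i ^ τ + 2
  have hσ : 1 < σ := by
    have : 0 ≤ ∑' i, mu i ^ τ := tsum_nonneg hnonneg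
    linarith
  obtain ⟨C, q, hC0, hq, hC⟩ := (isBigO_log_iff_exists_pow_le hσ).1 hI
  refine ⟨2 ^ k * Real.exp (2 * σ) * C, k + q, by positivity, by positivity, fun d hd A => ?_⟩
  have hd1 : (1 : ℝ) ≤ d := by exact_mod_cast hd
  calc ∑ o ∈ A, symWeight (I d) (fun i => mu i ^ τ) o
      ≤ (d + 1) ^ k * Real.exp (2 * σ) * σ ^ (d - (I d).card) :=
        sum_symWeight_le (i₀ := i₀) A hnonneg
          (fun i => Real.rpow_le_one (h0 i) (h1 i) hτ.le)
          (fun s => (hsum.sum_le_tsum s fun i _ => hnonneg i).trans (by linarith))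
          (fun i _ hi => by simpa using hi)
    _ ≤ (2 * d) ^ k * Real.exp (2 * σ) * (C * d ^ q) := by
        gcongr
        · linarith
        · exact hC d hd
    _ = 2 ^ k * Real.exp (2 * σ) * C * d ^ (k + q) := by
        rw [Real.rpow_add (by positivity), Real.rpow_natCast]
        ring

end Sufficiency

theorem ne_one_of_forall_sum_symWeight_le {ι : Type*} {ν : ι → ℝ} {I : (d : ℕ) → Finset (Fin d)}
    {C : ℝ} (hC : ∀ d, 1 ≤ d → ∀ A : Finset (SymIndex (I d) ι), ∑ o ∈ A, symWeight (I d) ν o ≤ C)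
    {i₀ i₁ : ι} (hi : i₀ ≠ i₁) (h : ν i₀ = 1) : ν i₁ ≠ 1 := by
  intro h'
  obtain ⟨d, hd⟩ := exists_nat_gt (max 1 (2 * C))
  rw [max_lt_iff, Nat.one_lt_cast] at hd
  have hin : ((I d).card : ℝ) + 1 ≤ C := card_add_one_le_of_sum_symWeight_le (hC d hd.1.le) hi h h'
  have hout : (1 + ν i₁) ^ (d - (I d).card) ≤ C :=
    one_add_pow_le_of_sum_symWeight_le (hC d hd.1.le) hi h
  have hbernoulli := one_add_mul_le_pow (a := ν i₁) (by linarith) (d - (I d).card)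
  rw [h', mul_one, natCast_sub_card] at hbernoulli
  rw [h'] at hout
  linarith

namespace IsSingularSystem

variable {H : Type*} [NormedAddCommGroup H] [InnerProductSpace ℝ H]
variable {G : Type*} [NormedAddCommGroup G] [InnerProductSpace ℝ G]
variable {S : H →L[ℝ] G} {ι : Type*} {b : HilbertBasis ι ℝ H} {mu : ι → ℝ}
  (h : IsSingularSystem S b mu) (I : (d : ℕ) → Finset (Fin d))

section Criterion

variable (h1 : ∀ i, mu i ≤ 1)
include h h1

theorem polynomiallyTractable_symProblem_iff_sum_le :
    PolynomiallyTractable (fun ε d => infoComplexity (symProblem S (I d)) ε) ↔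
      ∃ τ C q : ℝ, 0 < τ ∧ 0 < C ∧ 0 ≤ q ∧ ∀ d, 1 ≤ d → ∀ A : Finset (SymIndex (I d) ι),
        ∑ o ∈ A, symWeight (I d) (fun i => mu i ^ τ) o ≤ C * d ^ q := by
  choose B hB using fun d => h.exists_symProblem (I d)
  simp only [polynomiallyTractable_iff_sum_rpow_le hB
    fun _ => symWeight_le_one h.nonneg h1, symWeight_rpow h.nonneg]

theorem stronglyPolynomiallyTractable_symProblem_iff_sum_le :
    StronglyPolynomiallyTractable (fun ε d => infoComplexity (symProblem S (I d)) ε) ↔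
      ∃ τ C : ℝ, 0 < τ ∧ 0 < C ∧ ∀ d, 1 ≤ d → ∀ A : Finset (SymIndex (I d) ι),
        ∑ o ∈ A, symWeight (I d) (fun i => mu i ^ τ) o ≤ C := by
  choose B hB using fun d => h.exists_symProblem (I d)
  simp only [stronglyPolynomiallyTractable_iff_sum_rpow_le hB
    fun _ => symWeight_le_one h.nonneg h1, symWeight_rpow h.nonneg]

end Criterion

variable {i₀ i₁ : ι} (hi : i₀ ≠ i₁) (hmax : ∀ i, mu i ≤ mu i₀)
  (hone : mu i₀ ≤ 1) (hpos : 0 < mu i₁)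
include h hi hmax hone hpos

theorem stronglyPolynomiallyTractable_symProblem_iff (hsnd : ∀ i ≠ i₀, mu i ≤ mu i₁) :
    StronglyPolynomiallyTractable (fun ε d => infoComplexity (symProblem S (I d)) ε) ↔
      (∃ τ : ℝ, 0 < τ ∧ Summable fun i => mu i ^ τ) ∧
        (mu i₀ < 1 ∨ (mu i₀ = 1 ∧ mu i₁ < 1 ∧
          (fun d => ((d - (I d).card : ℕ) : ℝ)) =O[Filter.atTop] (fun _ => (1 : ℝ)))) := by
  have h1 (i) : mu i ≤ 1 := (hmax i).trans hone
  have : Nonempty ι := ⟨i₀⟩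
  rw [h.stronglyPolynomiallyTractable_symProblem_iff_sum_le I h1]
  constructor
  · rintro ⟨τ, C, hτ, hC0, hC⟩
    have hsum : Summable fun i => mu i ^ τ := summable_of_sum_le
      (fun i => Real.rpow_nonneg (h.nonneg i) τ) (sum_le_of_sum_symWeight_le (hC 1 le_rfl))
    refine ⟨⟨τ, hτ, hsum⟩, hone.lt_or_eq.imp_right fun hone => ?_⟩
    have hν : mu i₀ ^ τ = 1 := by rw [hone, Real.one_rpow]
    have hgt : 1 < 1 + mu i₁ ^ τ := lt_add_of_pos_right 1 (Real.rpow_pos_of_pos hpos τ)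
    refine ⟨hone, (h1 i₁).lt_of_ne fun hi₁ => ?_, ?_⟩
    · exact ne_one_of_forall_sum_symWeight_le hC hi hν (by rw [hi₁, Real.one_rpow])
    · exact (isBigO_one_iff_exists_pow_le hgt).2
        ⟨C, hC0, fun d hd =>
          one_add_pow_le_of_sum_symWeight_le (ν := fun i => mu i ^ τ) (hC d hd) hi hν⟩
  · rintro ⟨⟨τ, hτ, hsum⟩, hlt | ⟨-, hlt, hI⟩⟩
    · obtain ⟨τ', C, hτ', hC0, hC⟩ :=
        exists_sum_symWeight_rpow_le_of_le h.nonneg I hτ hsum hlt hmax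
      exact ⟨τ', C, hτ', hC0, fun d _ => hC d⟩
    · exact exists_sum_symWeight_rpow_le_of_isBigO_one h.nonneg h1 hτ hsum hpos.le hlt hsnd hI

theorem polynomiallyTractable_symProblem_iff :
    PolynomiallyTractable (fun ε d => infoComplexity (symProblem S (I d)) ε) ↔
      (∃ τ : ℝ, 0 < τ ∧ Summable fun i => mu i ^ τ) ∧
        (mu i₀ < 1 ∨ (mu i₀ = 1 ∧
          (fun d => ((d - (I d).card : ℕ) : ℝ)) =O[Filter.atTop]
            (fun d : ℕ => Real.log d))) := by
  have h1 (i) : mu i ≤ 1 := (hmax i).trans hone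
  have : Nonempty ι := ⟨i₀⟩
  rw [h.polynomiallyTractable_symProblem_iff_sum_le I h1]
  constructor
  · rintro ⟨τ, C, q, hτ, hC0, hq, hC⟩
    have hsum : Summable fun i => mu i ^ τ := summable_of_sum_le
      (fun i => Real.rpow_nonneg (h.nonneg i) τ) (sum_le_of_sum_symWeight_le (hC 1 le_rfl))
    refine ⟨⟨τ, hτ, hsum⟩, hone.lt_or_eq.imp_right fun hone => ⟨hone, ?_⟩⟩
    have hν : mu i₀ ^ τ = 1 := by rw [hone, Real.one_rpow]
    have hgt : 1 < 1 + mu i₁ ^ τ := lt_add_of_pos_right 1 (Real.rpow_pos_of_pos hpos τ)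
    exact (isBigO_log_iff_exists_pow_le hgt).2
      ⟨C, q, hC0, hq, fun d hd =>
        one_add_pow_le_of_sum_symWeight_le (ν := fun i => mu i ^ τ) (hC d hd) hi hν⟩
  · rintro ⟨⟨τ, hτ, hsum⟩, hlt | ⟨-, hI⟩⟩
    · obtain ⟨τ', C, hτ', hC0, hC⟩ :=
        exists_sum_symWeight_rpow_le_of_le h.nonneg I hτ hsum hlt hmax
      exact ⟨τ', C, 0, hτ', hC0, le_rfl, fun d _ A => by simpa using hC d A⟩
    · obtain ⟨C, q, hC0, hq, hC⟩ :=
        exists_sum_symWeight_rpow_le_of_isBigO_log h.nonneg h1 hτ hsum hI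
      exact ⟨τ, C, q, hτ, hC0, hq, hC⟩

end IsSingularSystem

end TensorProblem

end

theorem mainTheorem2 {H G : Type*}
    [NormedAddCommGroup H] [InnerProductSpace ℝ H] [CompleteSpace H]
    [NormedAddCommGroup G] [InnerProductSpace ℝ G] [CompleteSpace G]
    (S : H →L[ℝ] G) (hS : IsCompactOperator S)
    (lam : ℕ → ℝ) (hlam : TensorProblem.IsEigenvalueSeq (S.adjoint ∘L S) lam)
    (I : (d : ℕ) → Finset (Fin d)) (hI : ∀ d, 1 < d → (I d).Nonempty)
    (hlam_one : lam 0 ≤ 1) (hlam_two : 0 < lam 1) :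
    (TensorProblem.StronglyPolynomiallyTractable
        (fun ε d => TensorProblem.infoComplexity (TensorProblem.symProblem S (I d)) ε) ↔
      (∃ τ : ℝ, 0 < τ ∧ Summable fun m => lam m ^ τ) ∧
        (lam 0 < 1 ∨
          (lam 0 = 1 ∧ lam 1 < 1 ∧
            (fun d : ℕ => (d : ℝ) - ((I d).card : ℝ)) =O[Filter.atTop] fun _ => (1 : ℝ)))) ∧
    (TensorProblem.PolynomiallyTractable
        (fun ε d => TensorProblem.infoComplexity (TensorProblem.symProblem S (I d)) ε) ↔
      (∃ τ : ℝ, 0 < τ ∧ Summable fun m => lam m ^ τ) ∧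
        (lam 0 < 1 ∨
          (lam 0 = 1 ∧
            (fun d : ℕ => (d : ℝ) - ((I d).card : ℝ)) =O[Filter.atTop]
              fun d : ℕ => Real.log d))) := by
  obtain ⟨ι, b, mu, h, φ, hφ⟩ := TensorProblem.exists_isSingularSystem hS hlam
  obtain ⟨i₀, i₁, hi, h₀, h₁, hmax, hsnd⟩ :=
    TensorProblem.exists_two_largest_of_equiv_pos hlam.antitone hlam_two φ hφ
  have hsum : (∃ τ : ℝ, 0 < τ ∧ Summable fun m => lam m ^ τ) ↔
      ∃ τ : ℝ, 0 < τ ∧ Summable fun i => mu i ^ τ :=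
    exists_congr fun τ => and_congr_right fun hτ =>
      TensorProblem.summable_rpow_iff_of_equiv_pos h.nonneg hlam.nonneg φ hφ hτ
  simp only [hsum, ← TensorProblem.natCast_sub_card]
  rw [← h₀] at hlam_one ⊢
  rw [← h₁] at hlam_two ⊢
  exact ⟨h.stronglyPolynomiallyTractable_symProblem_iff I hi hmax hlam_one hlam_two hsnd,
    h.polynomiallyTractable_symProblem_iff I hi hmax hlam_one hlam_two⟩
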